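/- Let $\Omega\subset\mathbb{R}^d$ ($d\ge 1$) be a bounded polygonal (polyhedral) domain, i.e. a bounded, nonempty, connected open set equal to the interior of its closure, where $\overline\Omega$ is a finite union of nondegenerate $d$-simplices. Let $\mathcal{T}_h$ be a finite conforming simplicial mesh of $\overline\Omega$, and $\mathcal{E}_h^i$ the set of its interior edges (the $(d-1)$-dimensional faces shared by two elements). For each $e=\partial K\cap\partial L\in\mathcal{E}_h^i$ the order of the pair $(K,L)$ is fixed arbitrarily, $\boldsymbol n_e$ is the unit normal to $e$ exterior to $K$ and pointing to $L$, and $[\![ v ]\!]=v_K-v_L$ is the jump on $e$, where $v_K,v_L$ are the traces on $e$ of $v|_K,v|_L$. Let $\mathbb{P}_0^{\mathrm{disc}}(\mathcal{T}_h)$ be the space of (discontinuous) functions that are constant on each closed element; values on $\overline\Omega$ are understood element by element. Write $s_\oplus=\max\{s,0\}$, $s_\ominus=-\min\{s,0\}$. Let $\boldsymbol\beta:\overline\Omega\to\mathbb{R}^d$ be continuous, incompressible, i.e. $\nabla\cdot\boldsymbol\beta=0$ in $\Omega$ in the sense of distributions, and satisfy the slip condition $\boldsymbol\beta\cdot\boldsymbol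 n=0$ at every point of $\partial\Omega$ at which the outward unit normal $\boldsymbol n$ exists (that is, near which $\Omega$ is a half-space). Put $$a(\boldsymbol\beta;v,\overline v)=-\sum_{K\in\mathcal{T}_h}\int_K v\,(\boldsymbol\beta\cdot\nabla\overline v)+\sum_{e\in\mathcal{E}_h^i,\ e=\partial K\cap\partial L}\int_e\big((\boldsymbol\beta\cdot\boldsymbol n_e)_\oplus v_K-(\boldsymbol\beta\cdot\boldsymbol n_e)_\ominus v_L\big)[\![\overline v]\!].$$ Then for every time step $\Delta t>0$ and every $v^m\in\mathbb{P}_0^{\mathrm{disc}}(\mathcal{T}_h)$ there is exactly one $v^{m+1}\in\mathbb{P}_0^{\mathrm{disc}}(\mathcal{T}_h)$ solving the linear (non-truncated) upwind scheme $$\int_\Omega\frac{v^{m+1}-v^m}{\Delta t}\,\overline v+a(\boldsymbol\beta;v^{m+1},\overline v)=0\qquad\text{for all }\overline v\in\mathbb{P}_0^{\mathrm{disc}}(\mathcal{T}_h),$$ and it satisfies the maximum principle $$\min_{\overline\Omega}v^m\le v^{m+1}\le\max_{\overline\Omega}v^m\quad\text{in }\overline\Omega.$$ -/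

import Mathlib

open MeasureTheory
open scoped ContDiff RealInnerProductSpace

namespace UpwindDG

/-- `ℝ^d` with its Euclidean norm. -/
abbrev Space (d : ℕ) : Type := EuclideanSpace ℝ (Fin d)

/-- Bounded polygonal (polyhedral) domain of `ℝ^d`: a bounded, nonempty, connected open set that is
the interior of its closure (no cracks or punctures), the closure being a finite union of
nondegenerate `d`-simplices. -/
structure IsPolygonalDomain {d : ℕ} (Ω : Set (Space d)) : Prop where
  isOpen : IsOpen Ω
  isConnected : IsConnected Ω
  isBounded : Bornology.IsBounded Ω
  interior_closure : interior (closure Ω) = Ω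
  closure_eq : ∃ S : Finset (Finset (Space d)),
    (∀ s ∈ S, s.card = d + 1 ∧ AffineIndependent ℝ ((↑) : s → Space d)) ∧
      closure Ω = ⋃ s ∈ S, convexHull ℝ (s : Set (Space d))

/-- `n` is the outward unit normal of `Ω` at the boundary point `x`: near `x` the set `Ω` is the
open half-ball on the side of `-n`. On a polygonal domain such an `n` exists at every boundary
point lying in the relative interior of a flat piece of the boundary, hence almost everywhere. -/
def IsOutwardNormal {d : ℕ} (Ω : Set (Space d)) (x n : Space d) : Prop :=
  ‖n‖ = 1 ∧ ∃ r > 0, Ω ∩ Metric.ball x r = {y ∈ Metric.ball x r | ⟪y - x, n⟫ < 0}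

/-- Slip condition `β · n = 0` on `∂Ω`, at all points where the outward normal `n` exists. -/
def SlipCondition {d : ℕ} (Ω : Set (Space d)) (β : Space d → Space d) : Prop :=
  ∀ x n, IsOutwardNormal Ω x n → ⟪β x, n⟫ = 0

/-- `∇ · β = 0` in `Ω`, in the sense of distributions (`β` is only assumed continuous). -/
def Incompressible {d : ℕ} (Ω : Set (Space d)) (β : Space d → Space d) : Prop :=
  ∀ φ : Space d → ℝ, ContDiff ℝ ∞ φ → HasCompactSupport φ → tsupport φ ⊆ Ω →
    ∫ x in Ω, ⟪β x, gradient φ x⟫ = 0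

/-- Conforming simplicial mesh of `Ω`: a finite simplicial complex, all of whose faces lie in
`d`-dimensional ones, which covers `closure Ω`. A simplex is represented by its set of vertices. -/
structure Mesh {d : ℕ} (Ω : Set (Space d)) extends Geometry.SimplicialComplex ℝ (Space d) where
  finite_faces : faces.Finite
  pure : ∀ s ∈ faces, ∃ t ∈ faces, s ⊆ t ∧ t.card = d + 1
  space_eq : toSimplicialComplex.space = closure Ω

namespace Mesh

variable {d : ℕ} {Ω : Set (Space d)} (T : Mesh Ω)

open Classical in
/-- The elements of the mesh: its `d`-simplices. -/
noncomputable def elements : Finset (Finset (Space d)) :=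
  T.finite_faces.toFinset.filter fun s => s.card = d + 1

open Classical in
/-- The interior edges: the `(d-1)`-simplices shared by two different elements. -/
noncomputable def interiorEdges : Finset (Finset (Space d)) :=
  T.finite_faces.toFinset.filter fun e =>
    e.card = d ∧ ∃ K ∈ T.elements, ∃ L ∈ T.elements, K ≠ L ∧ e ⊆ K ∧ e ⊆ L

/-- A choice, for every interior edge `e = ∂K ∩ ∂L`, of which of its two elements is called `K`
(the normal `n_e` is exterior to `K`) and which one is called `L`. -/
structure Orientation where
  K : T.interiorEdges → T.elements
  L : T.interiorEdges → T.elements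
  ne : ∀ e, K e ≠ L e
  subset_K : ∀ e, e.1 ⊆ (K e).1
  subset_L : ∀ e, e.1 ⊆ (L e).1

/-- Functions defined element by element; `v K` is the function on the closed element `K`, so that
`v` has a trace from each side on every edge. -/
abbrev Broken : Type := T.elements → Space d → ℝ

/-- The discontinuous space `P_k^disc`: on each element `v` is a polynomial of total degree at most
`k` (the polynomial represents its restriction to the element, which determines it). -/
def Pdisc (k : ℕ) : Set T.Broken :=
  {v | ∀ K, ∃ p : MvPolynomial (Fin d) ℝ, p.totalDegree ≤ k ∧
    ∀ x : Space d, v K x = MvPolynomial.eval (fun i => x i) p}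

/-- The set of values taken by `v` on the closed elements, i.e. on `closure Ω`. -/
def values (v : T.Broken) : Set ℝ :=
  {r | ∃ K : T.elements, ∃ x ∈ convexHull ℝ (K.1 : Set (Space d)), v K x = r}

end Mesh

/-- Unit normal to the facet `e` of the simplex `K`, exterior to `K`: the normalized component
orthogonal to `e` of the vector from the barycentre of `K` to the barycentre of `e`. -/
noncomputable def outerNormal {d : ℕ} (K e : Finset (Space d)) : Space d :=
  let w := (vectorSpan ℝ (e : Set (Space d)))ᗮ.starProjection
    (e.centroid ℝ id - K.centroid ℝ id)
  ‖w‖⁻¹ • w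

namespace Mesh

variable {d : ℕ} {Ω : Set (Space d)} (T : Mesh Ω)

/-- The upwind form `a(β; v, w)`, the edge integrals being with respect to the
`(d-1)`-dimensional surface measure (normalized Hausdorff measure). -/
noncomputable def aUpw (O : T.Orientation) (β : Space d → Space d) (v w : T.Broken) : ℝ :=
  - (∑ K : T.elements, ∫ x in convexHull ℝ (K.1 : Set (Space d)),
      v K x * ⟪β x, gradient (w K) x⟫)
  + ∑ e : T.interiorEdges, ∫ x in convexHull ℝ (e.1 : Set (Space d)),
      (max ⟪β x, outerNormal (O.K e).1 e.1⟫ 0 * v (O.K e) x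
        - max (-⟪β x, outerNormal (O.K e).1 e.1⟫) 0 * v (O.L e) x)
        * (w (O.K e) x - w (O.L e) x) ∂μHE[d - 1]

/-- `v'` solves one step of length `τ` of the linear `P_0` upwind scheme starting from `v`:
`∫_Ω ((v' - v) / τ) w + a(β; v', w) = 0` for all `w` in `P_0^disc`. -/
def IsUpwindStep (O : T.Orientation) (β : Space d → Space d) (τ : ℝ) (v v' : T.Broken) : Prop :=
  v' ∈ T.Pdisc 0 ∧ ∀ w ∈ T.Pdisc 0,
    (∑ K : T.elements, ∫ x in convexHull ℝ (K.1 : Set (Space d)),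
      (v' K x - v K x) / τ * w K x) + T.aUpw O β v' w = 0

end Mesh

end UpwindDG

/-! On piecewise constants every gradient vanishes, so the scheme is a finite linear system on the
graph of elements. Interior edge `e` carries weights `P` and `N`, the integrals over `e` of the
positive and negative parts of `β · n_e`. If the net fluxes `P - N` balance at every element, the
form annihilates a constant first argument. Test with the indicator of an element where the new
solution is maximal, and subtract that constant: every edge term left is nonnegative, so the new
maximum is at most the old value there (`IsUpwindSolution.le`). The minimum follows by negation,
uniqueness by applying both bounds to a difference, existence by finite dimension
(`exists_isUpwindSolution`).

The work lies in the flux balance, since `β` is merely continuous and its divergence vanishes only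
as a distribution. On a simplex, incompressibility is tested against a product of cutoffs of the
barycentric coordinates divided by `δ`. The gradient of this product lives in layers of thickness of
order `δ` along the facets, and as `δ → 0` the layer integrals tend to facet integrals
(`tendsto_layer_integral`). Hence the total flux out of a simplex is zero
(`sum_integral_facet_eq_zero`). Facets belonging to one element lie on the boundary of the domain
and carry no flux by the slip condition (`flux_eq_zero_of_boundary`). The other facets belong to
exactly two elements, with opposite normals (`eq_or_eq_of_subset`, `outerNormal_eq_neg`), so the
balances regroup into a sum over interior edges (`sum_flux_mul_jump_eq_zero`). -/

namespace UpwindDG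

open Filter Topology Module

/-! ### A smooth cutoff on the line -/

section Cutoff

/-- A smooth cutoff on the line: `0` up to `1`, and `1` from `2` on. -/
noncomputable def cutoff (s : ℝ) : ℝ := Real.smoothTransition (s - 1)

lemma cutoff_of_le {s : ℝ} (h : s ≤ 1) : cutoff s = 0 :=
  Real.smoothTransition.zero_of_nonpos (by linarith)

lemma cutoff_of_ge {s : ℝ} (h : 2 ≤ s) : cutoff s = 1 :=
  Real.smoothTransition.one_of_one_le (by linarith)

lemma cutoff_nonneg (s : ℝ) : 0 ≤ cutoff s := Real.smoothTransition.nonneg _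

lemma cutoff_le_one (s : ℝ) : cutoff s ≤ 1 := Real.smoothTransition.le_one _

lemma contDiff_cutoff : ContDiff ℝ ∞ cutoff :=
  Real.smoothTransition.contDiff.comp (contDiff_id.sub contDiff_const)

lemma continuous_deriv_cutoff : Continuous (deriv cutoff) :=
  contDiff_cutoff.continuous_deriv (by simp)

lemma hasDerivAt_cutoff (s : ℝ) : HasDerivAt cutoff (deriv cutoff s) s :=
  (contDiff_cutoff.differentiable (by simp) s).hasDerivAt

lemma deriv_cutoff_of_notMem {s : ℝ} (h : s ∉ Set.Icc 1 2) : deriv cutoff s = 0 := by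
  rcases not_and_or.mp h with h | h
  · have : cutoff =ᶠ[𝓝 s] fun _ => 0 := by
      filter_upwards [Iio_mem_nhds (not_le.mp h)] with x hx using cutoff_of_le (le_of_lt hx)
    simpa using this.deriv_eq
  · have : cutoff =ᶠ[𝓝 s] fun _ => 1 := by
      filter_upwards [Ioi_mem_nhds (not_le.mp h)] with x hx using cutoff_of_ge (le_of_lt hx)
    simpa using this.deriv_eq

/-- This normalization makes the layer integrals converge to the facet integral with no extra
constant. -/
lemma integral_deriv_cutoff : ∫ s, deriv cutoff s = 1 := by
  have h := integral_of_hasDerivAt_of_tendsto (m := (0 : ℝ)) (n := 1) hasDerivAt_cutoff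
    (continuous_deriv_cutoff.integrable_of_hasCompactSupport
      (HasCompactSupport.intro isCompact_Icc fun _ h => deriv_cutoff_of_notMem h))
    (tendsto_const_nhds.congr' <| by
      filter_upwards [eventually_le_atBot 1] with x hx using (cutoff_of_le hx).symm)
    (tendsto_const_nhds.congr' <| by
      filter_upwards [eventually_ge_atTop 2] with x hx using (cutoff_of_ge hx).symm)
  simpa using h

lemma exists_deriv_cutoff_bound : ∃ C, 0 ≤ C ∧ ∀ s, |deriv cutoff s| ≤ C := by
  obtain ⟨C, hC⟩ := isCompact_Icc.exists_bound_of_continuousOn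
    (s := Set.Icc (1 : ℝ) 2) continuous_deriv_cutoff.continuousOn
  refine ⟨max C 0, le_max_right _ _, fun s => ?_⟩
  by_cases h : s ∈ Set.Icc (1 : ℝ) 2
  · exact (hC s h).trans (le_max_left _ _)
  · simp [deriv_cutoff_of_notMem h]

end Cutoff

/-! ### Orthogonal coordinates along a line and surface measure on hyperplanes -/

section Coordinates

variable {V : Type*} [NormedAddCommGroup V] [InnerProductSpace ℝ V] [FiniteDimensional ℝ V]
  [MeasurableSpace V] [BorelSpace V]

/-- Orthogonal coordinates `(t, y) ↦ t u + y + p` along a unit vector `u`. -/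
noncomputable def lineCoordinates (u : V) (hu : ‖u‖ = 1) (p : V) :
    ℝ × (ℝ ∙ u)ᗮ ≃ᵐ V :=
  ((LinearIsometryEquiv.toSpanUnitSingleton u hu).toMeasurableEquiv.prodCongr
    (MeasurableEquiv.refl _)).trans ((ℝ ∙ u).measurableEquivProd p).symm

lemma lineCoordinates_apply (u : V) (hu : ‖u‖ = 1) (p : V) (z : ℝ × (ℝ ∙ u)ᗮ) :
    lineCoordinates u hu p z = z.1 • u + z.2 + p := by
  simp [lineCoordinates]
  rfl

lemma measurePreserving_lineCoordinates (u : V) (hu : ‖u‖ = 1) (p : V) :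
    MeasurePreserving (lineCoordinates u hu p) := by
  have h1 := ((ℝ ∙ u).measurePreserving_measurableEquivProd p).symm
  rw [InnerProductSpace.euclideanHausdorffMeasure_eq_volume] at h1
  exact ((LinearIsometryEquiv.toSpanUnitSingleton u hu).measurePreserving.prod
    (MeasurePreserving.id _)).trans h1

/-- Orthogonal coordinates preserve volume, and stretching the first one costs the factor `c`. With
`c` proportional to `δ`, a thin layer becomes a slab of fixed width. -/
lemma integral_eq_mul_integral_lineCoordinates (u : V) (hu : ‖u‖ = 1) (p : V) {c : ℝ}
    (hc : 0 < c) (G : V → ℝ) :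
    ∫ x, G x = c * ∫ z : ℝ × (ℝ ∙ u)ᗮ, G ((c * z.1) • u + z.2 + p) := by
  rw [← (measurePreserving_lineCoordinates u hu p).integral_comp']
  simp_rw [lineCoordinates_apply]
  let f : ℝ × (ℝ ∙ u)ᗮ ≃ᵐ ℝ × (ℝ ∙ u)ᗮ :=
    (Homeomorph.mulLeft₀ c hc.ne').toMeasurableEquiv.prodCongr (MeasurableEquiv.refl _)
  have hf : Measure.map f volume = ENNReal.ofReal c⁻¹ • (volume : Measure (ℝ × (ℝ ∙ u)ᗮ)) := by
    have h := Measure.map_prod_map (volume : Measure ℝ) (volume : Measure (ℝ ∙ u)ᗮ)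
      (measurable_const_mul c) measurable_id
    rw [Real.map_volume_mul_left hc.ne', Measure.map_id, Measure.prod_smul_left,
      abs_of_pos (inv_pos.mpr hc)] at h
    exact h.symm
  have h2 : ∫ z : ℝ × (ℝ ∙ u)ᗮ, G ((c * z.1) • u + z.2 + p) =
      ∫ z, G (z.1 • u + z.2 + p) ∂(Measure.map f volume) := by
    rw [f.measurableEmbedding.integral_map]; rfl
  rw [h2, hf, integral_smul_measure, ENNReal.toReal_ofReal (inv_pos.mpr hc).le, smul_eq_mul,
    mul_inv_cancel_left₀ hc.ne']

/-- Translation by `p` embeds `S` isometrically, so it transports Hausdorff measure, which on `S`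
itself is the volume. -/
lemma setIntegral_image_add_eq (S : Submodule ℝ V) (p : V) {E : Set V}
    (hE : ∀ x ∈ E, x - p ∈ S) (F : V → ℝ) :
    ∫ x in E, F x ∂μHE[finrank ℝ S] = ∫ y : S in {y : S | (y : V) + p ∈ E}, F (y + p) := by
  have hiso : Isometry fun y : S => (y : V) + p :=
    (isometry_add_right p).comp isometry_subtype_coe
  have hemb : MeasurableEmbedding fun y : S => (y : V) + p :=
    hiso.isClosedEmbedding.measurableEmbedding
  have h := hemb.setIntegral_map (μ := μHE[finrank ℝ S]) F E
  rw [hiso.map_euclideanHausdorffMeasure, InnerProductSpace.euclideanHausdorffMeasure_eq_volume,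
    Measure.restrict_restrict_of_subset] at h
  · exact h
  · intro x hx
    exact ⟨⟨x - p, hE x hx⟩, by simp⟩

lemma hausdorffMeasure_lt_top_of_isCompact (S : Submodule ℝ V) (p : V) {E : Set V}
    (hE : ∀ x ∈ E, x - p ∈ S) (hc : IsCompact E) : μHE[finrank ℝ S] E < ⊤ := by
  have hiso : Isometry fun y : S => (y : V) + p :=
    (isometry_add_right p).comp isometry_subtype_coe
  have h := hiso.euclideanHausdorffMeasure_preimage (d := finrank ℝ S) E
  have hs : E ⊆ Set.range fun y : S => (y : V) + p := fun x hx => ⟨⟨x - p, hE x hx⟩, by simp⟩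
  rw [Set.inter_eq_left.mpr hs, InnerProductSpace.euclideanHausdorffMeasure_eq_volume] at h
  rw [← h]
  exact (hiso.isClosedEmbedding.isCompact_preimage hc).measure_lt_top

end Coordinates

/-! ### Barycentric coordinates and facet integrals as limits over layers -/

section Simplex

variable {V : Type*} [NormedAddCommGroup V] [InnerProductSpace ℝ V] [FiniteDimensional ℝ V]
variable {ι : Type*} (b : AffineBasis ι ℝ V)

/-- The gradient of a barycentric coordinate. -/
noncomputable def coordGrad (i : ι) : V :=
  (InnerProductSpace.toDual ℝ V).symm (LinearMap.toContinuousLinearMap (b.coord i).linear)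

lemma inner_coordGrad (i : ι) (v : V) : ⟪coordGrad b i, v⟫ = (b.coord i).linear v := by
  simp [coordGrad]

lemma coord_add (i : ι) (v x : V) : b.coord i (v + x) = ⟪coordGrad b i, v⟫ + b.coord i x := by
  rw [inner_coordGrad]
  exact (b.coord i).map_vadd x v

lemma inner_coordGrad_sub (i : ι) (x y : V) :
    ⟪coordGrad b i, x - y⟫ = b.coord i x - b.coord i y := by
  have := coord_add b i (x - y) y
  rw [sub_add_cancel] at this
  linarith

lemma coordGrad_ne_zero [Nontrivial ι] (i : ι) : coordGrad b i ≠ 0 := by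
  obtain ⟨j, hj⟩ := exists_ne i
  intro h
  have := inner_coordGrad_sub b i (b i) (b j)
  simp [h, b.coord_apply_ne hj.symm] at this

lemma continuous_coord (i : ι) : Continuous (b.coord i) :=
  (b.coord i).continuous_of_finiteDimensional

/-- The facet opposite to the vertex `i`. -/
def facet (i : ι) : Set V := {x | b.coord i x = 0 ∧ ∀ j, 0 ≤ b.coord j x}

omit [FiniteDimensional ℝ V] in
lemma facet_subset (i : ι) : facet b i ⊆ convexHull ℝ (Set.range b) := by
  rw [b.convexHull_eq_nonneg_coord]
  exact fun x hx => hx.2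

omit [FiniteDimensional ℝ V] in
lemma isCompact_convexHull_range [Finite ι] : IsCompact (convexHull ℝ (Set.range b)) :=
  (Set.finite_range b).isCompact_convexHull ℝ

lemma isCompact_facet [Finite ι] (i : ι) : IsCompact (facet b i) := by
  refine (isCompact_convexHull_range b).of_isClosed_subset ?_ (facet_subset b i)
  simp only [facet, Set.ofPred_and, Set.ofPred_forall]
  exact (isClosed_eq (continuous_coord b i) continuous_const).inter
    (isClosed_iInter fun j => isClosed_le continuous_const (continuous_coord b j))

lemma sub_mem_orthogonal_of_coord_eq {i : ι} {x y : V} (h : b.coord i x = b.coord i y) :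
    x - y ∈ (ℝ ∙ (‖coordGrad b i‖⁻¹ • coordGrad b i))ᗮ := by
  rw [Submodule.mem_orthogonal_singleton_iff_inner_right, real_inner_smul_left,
    inner_coordGrad_sub, h, sub_self, mul_zero]

lemma finrank_orthogonal_coordGrad [Nontrivial ι] (i : ι) :
    finrank ℝ (ℝ ∙ (‖coordGrad b i‖⁻¹ • coordGrad b i))ᗮ = finrank ℝ V - 1 := by
  have h : ‖coordGrad b i‖⁻¹ • coordGrad b i ≠ 0 :=
    smul_ne_zero (inv_ne_zero (norm_ne_zero_iff.mpr (coordGrad_ne_zero b i)))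
      (coordGrad_ne_zero b i)
  have h1 := Submodule.finrank_add_finrank_orthogonal (ℝ ∙ (‖coordGrad b i‖⁻¹ • coordGrad b i))
  rw [finrank_span_singleton h] at h1
  omega

variable [MeasurableSpace V] [BorelSpace V]

lemma hausdorffMeasure_facet_lt_top [Finite ι] [Nontrivial ι] (i : ι) :
    μHE[finrank ℝ V - 1] (facet b i) < ⊤ := by
  obtain ⟨j, hj⟩ := exists_ne i
  rw [← finrank_orthogonal_coordGrad b i]
  exact hausdorffMeasure_lt_top_of_isCompact _ (b j)
    (fun x hx => sub_mem_orthogonal_of_coord_eq b (by rw [hx.1, b.coord_apply_ne hj.symm]))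
    (isCompact_facet b i)

/-- The set is an affine subspace of the hyperplane, and a proper one: the vertex `b j` lies in the
hyperplane but has `j`-th coordinate `1`. -/
lemma volume_orthogonal_coord_eq_zero {i j : ι} (hij : j ≠ i) {p : V} (hp : b.coord i p = 0) :
    volume {y : (ℝ ∙ (‖coordGrad b i‖⁻¹ • coordGrad b i))ᗮ | b.coord j (y + p) = 0} = 0 := by
  set S := (ℝ ∙ (‖coordGrad b i‖⁻¹ • coordGrad b i))ᗮ
  let l : S →ᵃ[ℝ] ℝ := (b.coord j).comp ((S.subtype.toAffineMap) + AffineMap.const ℝ S p)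
  have hl : ∀ y : S, l y = b.coord j (y + p) := fun y => rfl
  have h := Measure.addHaar_affineSubspace (volume : Measure S)
    ((AffineSubspace.mk' (0 : ℝ) (⊥ : Submodule ℝ ℝ)).comap l) ?_
  · convert h using 2
    ext y
    simp [AffineSubspace.mem_mk', hl]
  · intro htop
    have hmem : b j - p ∈ S :=
      sub_mem_orthogonal_of_coord_eq b (by rw [hp, b.coord_apply_ne hij.symm])
    have h1 : (⟨b j - p, hmem⟩ : S) ∈
        (AffineSubspace.mk' (0 : ℝ) (⊥ : Submodule ℝ ℝ)).comap l := by
      rw [htop]; trivial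
    simp [AffineSubspace.mem_mk', hl] at h1

/-- The integral over a facet as a limit of integrals over thin layers. -/
theorem tendsto_layer_integral [Fintype ι] [DecidableEq ι] [Nontrivial ι] (i : ι) {F : V → ℝ}
    (hF : Continuous F) :
    Tendsto (fun δ : ℝ => δ⁻¹ * ∫ x, F x * (deriv cutoff (b.coord i x / δ) *
        ∏ j ∈ Finset.univ.erase i, cutoff (b.coord j x / δ))) (𝓝[>] 0)
      (𝓝 (‖coordGrad b i‖⁻¹ * ∫ x in facet b i, F x ∂μHE[finrank ℝ V - 1])) := by
  obtain ⟨k, hk⟩ := exists_ne i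
  set g := coordGrad b i with hg
  have hg0 : 0 < ‖g‖ := norm_pos_iff.mpr (coordGrad_ne_zero b i)
  set u := ‖g‖⁻¹ • g with hu
  have hu1 : ‖u‖ = 1 := by
    rw [hu, norm_smul, norm_inv, norm_norm, inv_mul_cancel₀ hg0.ne']
  have hgu : ⟪g, u⟫ = ‖g‖ := by
    rw [hu, real_inner_smul_right, real_inner_self_eq_norm_sq]
    field_simp
  obtain ⟨p, hp⟩ : ∃ p, b.coord i p = 0 := ⟨b k, b.coord_apply_ne hk.symm⟩
  -- The scaling `δ / ‖g‖` is chosen so that the `i`-th coordinate of `Φ δ z` is exactly `δ * z.1`;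
  -- the factor `deriv cutoff z.1` then no longer depends on `δ`.
  let Φ : ℝ → ℝ × (ℝ ∙ u)ᗮ → V := fun δ z => (δ / ‖g‖ * z.1) • u + z.2 + p
  have hyu : ∀ y : (ℝ ∙ u)ᗮ, ⟪u, (y : V)⟫ = 0 := fun y =>
    (Submodule.mem_orthogonal_singleton_iff_inner_right).mp y.2
  have hyg : ∀ y : (ℝ ∙ u)ᗮ, ⟪g, (y : V)⟫ = 0 := fun y => by
    have h : g = ‖g‖ • u := by rw [hu, smul_smul, mul_inv_cancel₀ hg0.ne', one_smul]
    refine (congrArg (fun w => ⟪w, (y : V)⟫) h).trans ?_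
    rw [real_inner_smul_left, hyu, mul_zero]
  have hΦi : ∀ δ z, b.coord i (Φ δ z) = δ * z.1 := fun δ z => by
    simp only [Φ]
    rw [coord_add, ← hg, inner_add_right, real_inner_smul_right, hgu, hyg, hp]
    field_simp
    ring
  have hΦc : ∀ z, Continuous fun δ => Φ δ z := fun z => by simp only [Φ]; fun_prop
  have hΦc' : ∀ δ, Continuous (Φ δ) := fun δ => by simp only [Φ]; fun_prop
  have hΦ0 : ∀ z, Φ 0 z = z.2 + p := fun z => by simp [Φ]
  let H : ℝ → ℝ × (ℝ ∙ u)ᗮ → ℝ := fun δ z => F (Φ δ z) * (deriv cutoff z.1 *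
        ∏ j ∈ Finset.univ.erase i, cutoff (b.coord j (Φ δ z) / δ))
  have hH : ∀ δ > 0, δ⁻¹ * ∫ x, F x * (deriv cutoff (b.coord i x / δ) *
        ∏ j ∈ Finset.univ.erase i, cutoff (b.coord j x / δ)) = ‖g‖⁻¹ * ∫ z, H δ z := by
    intro δ hδ
    rw [integral_eq_mul_integral_lineCoordinates u hu1 p (div_pos hδ hg0), ← mul_assoc]
    congr 1
    · field_simp
    · refine integral_congr_ae (Eventually.of_forall fun z => ?_)
      have : b.coord i (Φ δ z) / δ = z.1 := by rw [hΦi]; field_simp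
      change F (Φ δ z) * (deriv cutoff (b.coord i (Φ δ z) / δ) * _) = _
      rw [this]
  set E : Set (ℝ ∙ u)ᗮ := {y | (y : V) + p ∈ facet b i} with hE
  have hEm : MeasurableSet E :=
    ((isCompact_facet b i).isClosed.preimage
      (by fun_prop : Continuous fun y : (ℝ ∙ u)ᗮ => (y : V) + p)).measurableSet
  have hlim : ‖g‖⁻¹ * ∫ x in facet b i, F x ∂μHE[finrank ℝ V - 1] =
      ‖g‖⁻¹ * ∫ z : ℝ × (ℝ ∙ u)ᗮ, deriv cutoff z.1 *
        E.indicator (fun y => F (y + p)) z.2 := by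
    rw [Measure.volume_eq_prod, integral_prod_mul, integral_deriv_cutoff, one_mul,
      integral_indicator hEm, ← finrank_orthogonal_coordGrad b i]
    congr 1
    exact setIntegral_image_add_eq _ p
      (fun x hx => sub_mem_orthogonal_of_coord_eq b (by rw [hx.1, hp])) F
  rw [hlim]
  suffices hT : Tendsto (fun δ => ∫ z, H δ z) (𝓝[>] 0)
      (𝓝 (∫ z : ℝ × (ℝ ∙ u)ᗮ, deriv cutoff z.1 * E.indicator (fun y => F (y + p)) z.2)) by
    refine (hT.const_mul _).congr' ?_
    filter_upwards [self_mem_nhdsWithin] with δ hδ using (hH δ hδ).symm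
  obtain ⟨C, hC0, hC⟩ := exists_deriv_cutoff_bound
  obtain ⟨M, hM⟩ := (isCompact_convexHull_range b).exists_bound_of_continuousOn hF.continuousOn
  obtain ⟨R, hR⟩ := (isCompact_convexHull_range b).exists_bound_of_continuousOn
    (f := fun x => x - p) (by fun_prop)
  -- Where the integrand is nonzero, `z.1` lies in `[1, 2]` and `Φ δ z` in the simplex. Since `u` is
  -- orthogonal to `z.2`, this bounds `‖z.2‖` by `R`, uniformly in `δ`.
  refine tendsto_integral_filter_of_dominated_convergence
    ((Set.Icc (1 : ℝ) 2 ×ˢ Metric.closedBall (0 : (ℝ ∙ u)ᗮ) R).indicator fun _ => M * C)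
    ?_ ?_ ?_ ?_
  · refine Eventually.of_forall fun δ => Continuous.aestronglyMeasurable ?_
    refine (hF.comp (hΦc' δ)).mul ((continuous_deriv_cutoff.comp continuous_fst).mul ?_)
    exact continuous_finsetProd _ fun j _ => contDiff_cutoff.continuous.comp
      (((continuous_coord b j).comp (hΦc' δ)).div_const δ)
  · filter_upwards [self_mem_nhdsWithin] with δ (hδ : 0 < δ)
    refine Eventually.of_forall fun z => ?_
    by_cases hz : H δ z = 0
    · rw [hz, norm_zero]
      refine Set.indicator_nonneg (fun _ _ => mul_nonneg ?_ hC0) _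
      exact (norm_nonneg _).trans (hM (b i) (subset_convexHull ℝ _ ⟨i, rfl⟩))
    · have h1 : deriv cutoff z.1 ≠ 0 := fun h => hz (by simp [H, h])
      have h2 : ∀ j ≠ i, cutoff (b.coord j (Φ δ z) / δ) ≠ 0 := fun j hj h => hz (by
        simp only [H]
        rw [Finset.prod_eq_zero (Finset.mem_erase.mpr ⟨hj, Finset.mem_univ j⟩) h]
        simp)
      have hz1 : z.1 ∈ Set.Icc (1 : ℝ) 2 := by
        by_contra h
        exact h1 (deriv_cutoff_of_notMem h)
      have hK : Φ δ z ∈ convexHull ℝ (Set.range b) := by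
        rw [b.convexHull_eq_nonneg_coord]
        intro j
        by_cases hj : j = i
        · rw [hj, hΦi]
          exact mul_nonneg hδ.le (zero_le_one.trans hz1.1)
        · by_contra hneg
          refine h2 j hj (cutoff_of_le ?_)
          exact (div_nonpos_of_nonpos_of_nonneg (not_le.mp hneg).le hδ.le).trans zero_le_one
      have hy : ‖z.2‖ ≤ R := by
        refine le_trans ?_ (hR _ hK)
        have h3 : Φ δ z - p = (δ / ‖g‖ * z.1) • u + z.2 := by simp [Φ]
        have h4 := norm_add_sq_eq_norm_sq_add_norm_sq_of_inner_eq_zero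
          ((δ / ‖g‖ * z.1) • u) (z.2 : V) (by rw [real_inner_smul_left, hyu, mul_zero])
        rw [h3]
        refine abs_le_of_sq_le_sq' ?_ (norm_nonneg _) |>.2
        rw [← Submodule.norm_coe]
        nlinarith [norm_nonneg ((δ / ‖g‖ * z.1) • u)]
      rw [Set.indicator_of_mem (Set.mk_mem_prod hz1 (by simpa using hy))]
      simp only [H, norm_mul]
      have h5 : ‖∏ j ∈ Finset.univ.erase i, cutoff (b.coord j (Φ δ z) / δ)‖ ≤ 1 := by
        rw [norm_prod]
        refine Finset.prod_le_one (fun _ _ => norm_nonneg _) fun j _ => ?_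
        rw [Real.norm_of_nonneg (cutoff_nonneg _)]
        exact cutoff_le_one _
      have h6 : ‖deriv cutoff z.1‖ * ‖∏ j ∈ Finset.univ.erase i,
          cutoff (b.coord j (Φ δ z) / δ)‖ ≤ C := by
        simpa using mul_le_mul (hC z.1) h5 (norm_nonneg _) hC0
      exact mul_le_mul (hM _ hK) h6 (by positivity) ((norm_nonneg _).trans (hM _ hK))
  · rw [integrable_indicator_iff (measurableSet_Icc.prod Metric.isClosed_closedBall.measurableSet)]
    exact integrableOn_const
      (isCompact_Icc.prod (isCompact_closedBall _ _)).measure_lt_top.ne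
  -- Off the null set where another coordinate vanishes on the facet hyperplane, each remaining
  -- cutoff tends to `1` or `0` according to the sign of its coordinate. The limit of the product is
  -- the indicator of the facet.
  · have hN : ∀ᵐ z : ℝ × (ℝ ∙ u)ᗮ, ∀ j, j ≠ i → b.coord j (z.2 + p) ≠ 0 := by
      rw [ae_all_iff]
      intro j
      by_cases hj : j = i
      · exact Eventually.of_forall fun z h => absurd hj h
      · have h : ∀ᵐ y : (ℝ ∙ u)ᗮ, b.coord j (y + p) ≠ 0 := by
          rw [ae_iff]
          simpa using volume_orthogonal_coord_eq_zero b hj hp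
        filter_upwards [Measure.quasiMeasurePreserving_snd.ae h] with z hz _ using hz
    filter_upwards [hN] with z hz
    have hlimj : ∀ j, Tendsto (fun δ => b.coord j (Φ δ z)) (𝓝[>] 0) (𝓝 (b.coord j (z.2 + p))) := by
      intro j
      have := ((continuous_coord b j).comp (hΦc z)).tendsto 0
      simp only [Function.comp_apply, hΦ0] at this
      exact this.mono_left nhdsWithin_le_nhds
    have hFlim : Tendsto (fun δ => F (Φ δ z)) (𝓝[>] 0) (𝓝 (F (z.2 + p))) := by
      have := (hF.comp (hΦc z)).tendsto 0
      simp only [Function.comp_apply, hΦ0] at this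
      exact this.mono_left nhdsWithin_le_nhds
    by_cases hzE : z.2 ∈ E
    · rw [Set.indicator_of_mem hzE, mul_comm]
      refine hFlim.mul ?_
      have hprod : Tendsto (fun δ => ∏ j ∈ Finset.univ.erase i, cutoff (b.coord j (Φ δ z) / δ))
          (𝓝[>] 0) (𝓝 (∏ j ∈ Finset.univ.erase i, 1)) := by
        refine tendsto_finsetProd _ fun j hj => tendsto_const_nhds.congr' ?_
        have hpos : 0 < b.coord j (z.2 + p) :=
          lt_of_le_of_ne (hzE.2 j) (hz j (Finset.ne_of_mem_erase hj)).symm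
        have := ((hlimj j).pos_mul_atTop hpos tendsto_inv_nhdsGT_zero).eventually_ge_atTop 2
        filter_upwards [this] with δ hδ
        exact (cutoff_of_ge (by rwa [div_eq_mul_inv])).symm
      simpa using hprod.const_mul (deriv cutoff z.1)
    · rw [Set.indicator_of_notMem hzE, mul_zero]
      obtain ⟨j, hji, hj⟩ : ∃ j, j ≠ i ∧ b.coord j (z.2 + p) < 0 := by
        by_contra! h
        refine hzE ⟨?_, fun j => ?_⟩
        · rw [coord_add, ← hg, hyg, hp, add_zero]
        · by_cases hj : j = i
          · rw [hj, coord_add, ← hg, hyg, hp, add_zero]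
          · exact h j hj
      refine tendsto_const_nhds.congr' ?_
      filter_upwards [(hlimj j).eventually (Iio_mem_nhds hj), self_mem_nhdsWithin]
        with δ hδ (hδ0 : 0 < δ)
      simp only [H]
      rw [Finset.prod_eq_zero (Finset.mem_erase.mpr ⟨hji, Finset.mem_univ j⟩)
        (cutoff_of_le ((div_nonpos_of_nonpos_of_nonneg (le_of_lt hδ) hδ0.le).trans zero_le_one))]
      simp

end Simplex

/-! ### Total flux of a weakly divergence-free field out of a simplex -/

section Flux

variable {V : Type*} [NormedAddCommGroup V] [InnerProductSpace ℝ V] [FiniteDimensional ℝ V]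
variable {ι : Type*} [Fintype ι] (b : AffineBasis ι ℝ V)

/-- A smooth approximation of the indicator function of a simplex, supported in its interior. -/
noncomputable def bump (δ : ℝ) (x : V) : ℝ := ∏ j, cutoff (b.coord j x / δ)

omit [Fintype ι] in
lemma contDiff_coord (j : ι) : ContDiff ℝ ∞ (b.coord j) := by
  have h : (b.coord j : V → ℝ) = fun x => ⟪coordGrad b j, x⟫ + b.coord j 0 := by
    ext x
    simpa using coord_add b j x 0
  rw [h]
  exact (contDiff_const.inner ℝ contDiff_id).add contDiff_const

lemma contDiff_bump (δ : ℝ) : ContDiff ℝ ∞ (bump b δ) :=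
  contDiff_prod fun j _ => contDiff_cutoff.comp ((contDiff_coord b j).div_const δ)

/-- This is why `cutoff` vanishes up to `1` and not only up to `0`: the support stays away from the
facets. -/
lemma tsupport_bump_subset {δ : ℝ} (hδ : 0 < δ) :
    tsupport (bump b δ) ⊆ {x | ∀ j, δ ≤ b.coord j x} := by
  refine closure_minimal (fun x hx j => ?_) ?_
  · by_contra h
    refine hx (Finset.prod_eq_zero (Finset.mem_univ j) (cutoff_of_le ?_))
    exact (div_le_one hδ).mpr (not_le.mp h).le
  · simp only [Set.ofPred_forall]
    exact isClosed_iInter fun j => isClosed_le continuous_const (continuous_coord b j)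

lemma tsupport_bump_subset_interior {δ : ℝ} (hδ : 0 < δ) :
    tsupport (bump b δ) ⊆ interior (convexHull ℝ (Set.range b)) := by
  rw [b.interior_convexHull]
  exact fun x hx j => hδ.trans_le (tsupport_bump_subset b hδ hx j)

lemma hasCompactSupport_bump {δ : ℝ} (hδ : 0 < δ) : HasCompactSupport (bump b δ) :=
  (isCompact_convexHull_range b).of_isClosed_subset (isClosed_tsupport _)
    ((tsupport_bump_subset_interior b hδ).trans interior_subset)

/-- The product rule, arranged so that the `i`-th term is the integrand of `tendsto_layer_integral`
for facet `i`. -/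
lemma inner_gradient_bump [DecidableEq ι] (δ : ℝ) (x v : V) :
    ⟪v, gradient (bump b δ) x⟫ = ∑ i, δ⁻¹ * (⟪v, coordGrad b i⟫ *
      (deriv cutoff (b.coord i x / δ) *
        ∏ j ∈ Finset.univ.erase i, cutoff (b.coord j x / δ))) := by
  have h1 : ∀ i, HasFDerivAt (fun x => cutoff (b.coord i x / δ))
      (deriv cutoff (b.coord i x / δ) • δ⁻¹ • innerSL ℝ (coordGrad b i)) x := by
    intro i
    have h2 : HasFDerivAt (fun y => b.coord i y) (innerSL ℝ (coordGrad b i)) x := by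
      have h : (b.coord i : V → ℝ) = fun x => innerSL ℝ (coordGrad b i) x + b.coord i 0 := by
        ext x
        simpa using coord_add b i x 0
      rw [h]
      exact (innerSL ℝ (coordGrad b i)).hasFDerivAt.add_const _
    have h3 : HasFDerivAt (fun y => b.coord i y / δ) (δ⁻¹ • innerSL ℝ (coordGrad b i)) x := by
      simpa [div_eq_mul_inv, mul_comm] using h2.const_mul δ⁻¹
    exact (hasDerivAt_cutoff _).comp_hasFDerivAt x h3
  have h4 := (HasFDerivAt.finsetProd (u := Finset.univ) fun i _ => h1 i)
  have h5 : fderiv ℝ (bump b δ) x = _ := h4.fderiv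
  rw [real_inner_comm, inner_gradient_left, h5]
  simp only [_root_.sum_apply, _root_.smul_apply, innerSL_apply_apply,
    smul_eq_mul]
  refine Finset.sum_congr rfl fun i _ => ?_
  rw [real_inner_comm]
  ring

variable [MeasurableSpace V] [BorelSpace V]

/-- A continuous field that is divergence-free in the interior of a simplex, in the sense of
distributions, has zero total flux through the boundary of the simplex. -/
theorem sum_integral_facet_eq_zero [Nontrivial ι] {F : V → V} (hF : Continuous F)
    (hdiv : ∀ φ : V → ℝ, ContDiff ℝ ∞ φ → HasCompactSupport φ →
      tsupport φ ⊆ interior (convexHull ℝ (Set.range b)) → ∫ x, ⟪F x, gradient φ x⟫ = 0) :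
    ∑ i, ∫ x in facet b i, ⟪F x, ‖coordGrad b i‖⁻¹ • coordGrad b i⟫
      ∂μHE[finrank ℝ V - 1] = 0 := by
  classical
  have hFi : ∀ i, Continuous fun x => ⟪F x, coordGrad b i⟫ := fun i => by fun_prop
  have hlim := tendsto_finsetSum Finset.univ fun i _ => tendsto_layer_integral b i (hFi i)
  have h0 : ∀ δ > 0, ∑ i, (δ⁻¹ * ∫ x, ⟪F x, coordGrad b i⟫ * (deriv cutoff (b.coord i x / δ) *
        ∏ j ∈ Finset.univ.erase i, cutoff (b.coord j x / δ))) = 0 := by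
    intro δ hδ
    rw [← hdiv (bump b δ) (contDiff_bump b δ) (hasCompactSupport_bump b hδ)
      (tsupport_bump_subset_interior b hδ)]
    simp_rw [inner_gradient_bump]
    rw [integral_finsetSum]
    · simp_rw [integral_const_mul]
    · intro i _
      refine Integrable.const_mul (Continuous.integrable_of_hasCompactSupport ?_ ?_) _
      · refine (hFi i).mul ((continuous_deriv_cutoff.comp
          ((continuous_coord b i).div_const δ)).mul ?_)
        exact continuous_finsetProd _ fun j _ => contDiff_cutoff.continuous.comp
          ((continuous_coord b j).div_const δ)
      · refine HasCompactSupport.intro (isCompact_convexHull_range b) fun x hx => ?_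
        rw [b.convexHull_eq_nonneg_coord] at hx
        obtain ⟨j, hj⟩ := not_forall.mp hx
        have hj' : b.coord j x / δ ≤ 0 := div_nonpos_of_nonpos_of_nonneg (not_le.mp hj).le hδ.le
        by_cases hji : j = i
        · subst hji
          rw [deriv_cutoff_of_notMem fun h => by linarith [h.1]]
          simp
        · rw [Finset.prod_eq_zero (Finset.mem_erase.mpr ⟨hji, Finset.mem_univ j⟩)
            (cutoff_of_le (hj'.trans zero_le_one))]
          simp
  have h1 := tendsto_nhds_unique (hlim.congr' (f₂ := fun _ => 0) (by
    filter_upwards [self_mem_nhdsWithin] with δ hδ using h0 δ hδ)) tendsto_const_nhds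
  rw [← h1]
  refine Finset.sum_congr rfl fun i _ => ?_
  simp_rw [real_inner_smul_right, integral_const_mul]

end Flux

/-! ### Facets of a simplex and their exterior normals -/

section SimplexGeometry

variable {d : ℕ} {K : Finset (Space d)}

/-- The vertices of a nondegenerate `d`-simplex, as an affine basis. -/
noncomputable def simplexBasis (hK : AffineIndependent ℝ ((↑) : K → Space d))
    (hc : K.card = d + 1) : AffineBasis K ℝ (Space d) :=
  ⟨(↑), hK, hK.affineSpan_eq_top_iff_card_eq_finrank_add_one.mpr (by simp [hc])⟩

variable (hK : AffineIndependent ℝ ((↑) : K → Space d)) (hc : K.card = d + 1)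

lemma range_simplexBasis : Set.range (simplexBasis hK hc) = (K : Set (Space d)) :=
  Subtype.range_coe

lemma nontrivial_of_card (hd : 1 ≤ d) (hc : K.card = d + 1) : Nontrivial K := by
  rw [← Fintype.one_lt_card_iff_nontrivial, Fintype.card_coe]
  omega

/-- Links facets given by vertex sets with facets given by coordinates. A point whose `i`-th
coordinate is zero is the barycentric combination of the other vertices. -/
lemma convexHull_erase_eq_facet [DecidableEq (Space d)] (i : K) :
    convexHull ℝ (K.erase i : Set (Space d)) = facet (simplexBasis hK hc) i := by
  set b := simplexBasis hK hc
  apply subset_antisymm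
  · refine fun x hx => ⟨?_, ?_⟩
    · have hconv : Convex ℝ {x | b.coord i x = 0} :=
        (convex_singleton (0 : ℝ)).affine_preimage (b.coord i)
      refine convexHull_min (fun y hy => ?_) hconv hx
      have hy' := Finset.mem_erase.mp (Finset.mem_coe.mp hy)
      exact b.coord_apply_ne (i := i) (j := ⟨y, hy'.2⟩) fun h => hy'.1 (by rw [h])
    · have h := convexHull_mono (𝕜 := ℝ)
        (Finset.coe_subset.mpr (Finset.erase_subset (i : Space d) K)) hx
      rw [← range_simplexBasis hK hc, AffineBasis.convexHull_eq_nonneg_coord] at h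
      exact h
  · intro x hx
    have hsum : ∑ j ∈ Finset.univ.erase i, b.coord j x • b j = x := by
      rw [Finset.sum_erase _ (by rw [hx.1, zero_smul])]
      exact b.linear_combination_coord_eq_self x
    rw [← hsum]
    refine (convex_convexHull ℝ _).sum_mem (fun j _ => hx.2 j) ?_ fun j hj => ?_
    · rw [Finset.sum_erase (f := fun j => b.coord j x) _ hx.1]
      exact b.sum_coord_apply_eq_one x
    · refine subset_convexHull ℝ _ (Finset.mem_coe.mpr (Finset.mem_erase.mpr ⟨?_, j.2⟩))
      exact fun h => Finset.ne_of_mem_erase hj (Subtype.ext h)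

lemma exists_eq_erase [DecidableEq (Space d)] {e : Finset (Space d)} (he : e ⊆ K)
    (hec : e.card = d) (hc : K.card = d + 1) : ∃ i : K, e = K.erase i := by
  obtain ⟨i, hi, h⟩ := (Finset.covBy_iff_exists_cons.mp
    (Finset.covBy_iff_card_sdiff_eq_one.mpr ⟨he, by
      rw [Finset.card_sdiff_of_subset he, hc, hec]; omega⟩))
  have hiK : i ∈ K := by rw [← h]; simp
  have h' : K.erase i = e := by rw [← h, Finset.cons_eq_insert, Finset.erase_insert hi]
  exact ⟨⟨i, hiK⟩, h'.symm⟩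

/-- Makes the barycentre of a facet the standard example of a point in its relative interior. -/
lemma coord_centroid_erase [DecidableEq (Space d)] (i : K) {j : K} (hj : j ≠ i) :
    0 < (simplexBasis hK hc).coord j ((K.erase i).centroid ℝ id) := by
  have h : K.erase (i : Space d) = (Finset.univ.erase i).map (Function.Embedding.subtype _) := by
    ext x
    rw [Finset.mem_erase, Finset.mem_map]
    constructor
    · exact fun hx => ⟨⟨x, hx.2⟩, Finset.mem_erase.mpr
        ⟨fun h => hx.1 (congrArg Subtype.val h), Finset.mem_univ _⟩, rfl⟩
    · rintro ⟨y, hy, rfl⟩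
      exact ⟨fun h => Finset.ne_of_mem_erase hy (Subtype.ext h), y.2⟩
  rw [h, Finset.centroid_map]
  change 0 < (simplexBasis hK hc).coord j
    (Finset.centroid ℝ (Finset.univ.erase i) (simplexBasis hK hc))
  have hmem : j ∈ Finset.univ.erase i := Finset.mem_erase.mpr ⟨hj, Finset.mem_univ j⟩
  rw [AffineBasis.coord_apply_centroid _ hmem]
  exact inv_pos.mpr (Nat.cast_pos.mpr (Finset.card_pos.mpr ⟨j, hmem⟩))

lemma centroid_erase_mem_facet [DecidableEq (Space d)] (hd : 1 ≤ d) (i : K) :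
    (K.erase i).centroid ℝ id ∈ facet (simplexBasis hK hc) i := by
  rw [← convexHull_erase_eq_facet]
  refine Finset.centroid_mem_convexHull _ (Finset.card_pos.mp ?_)
  rw [Finset.card_erase_of_mem i.2]
  omega

/-- The directions of the facet are orthogonal to the coordinate gradient, and both spaces have
dimension `d - 1`. -/
lemma orthogonal_vectorSpan_erase [DecidableEq (Space d)] (hd : 1 ≤ d) (i : K) :
    (vectorSpan ℝ (K.erase i : Set (Space d)))ᗮ = ℝ ∙ coordGrad (simplexBasis hK hc) i := by
  have := nontrivial_of_card hd hc
  set b := simplexBasis hK hc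
  have hg := coordGrad_ne_zero b i
  have hind : AffineIndependent ℝ ((↑) : ↥(K.erase (i : Space d)) → Space d) :=
    hK.mono (Finset.coe_subset.mpr (Finset.erase_subset _ _))
  have hcard : (K.erase (i : Space d)).card = d := by
    rw [Finset.card_erase_of_mem i.2]; omega
  have hdim : finrank ℝ (vectorSpan ℝ (K.erase i : Set (Space d))) = d - 1 := by
    have h := hind.finrank_vectorSpan (n := d - 1) (by rw [Fintype.card_coe]; omega)
    have hr : Set.range ((↑) : ↥(K.erase (i : Space d)) → Space d) = (K.erase i : Set (Space d)) :=
      Subtype.range_coe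
    exact (congrArg (fun s => finrank ℝ (vectorSpan ℝ s)) hr).symm.trans h
  have hle : vectorSpan ℝ (K.erase i : Set (Space d)) ≤ (ℝ ∙ coordGrad b i)ᗮ := by
    rw [vectorSpan_def, Submodule.span_le]
    rintro _ ⟨x, hx, y, hy, rfl⟩
    have hcoord : ∀ z ∈ (K.erase i : Set (Space d)), b.coord i z = 0 := fun z hz =>
      (convexHull_erase_eq_facet hK hc i ▸ subset_convexHull ℝ _ hz :
        z ∈ facet b i).1
    rw [SetLike.mem_coe, Submodule.mem_orthogonal_singleton_iff_inner_right]
    change ⟪coordGrad b i, x - y⟫ = 0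
    rw [inner_coordGrad_sub, hcoord x hx, hcoord y hy, sub_self]
  have h1 := Submodule.finrank_add_finrank_orthogonal (ℝ ∙ coordGrad b i)
  rw [finrank_span_singleton hg, finrank_euclideanSpace_fin] at h1
  rw [Submodule.eq_of_le_of_finrank_eq hle (by omega), Submodule.orthogonal_orthogonal]

/-- The projection in `outerNormal` is onto the line of the coordinate gradient. Its coefficient is
negative, because the `i`-th coordinate falls from a positive value at the barycentre of `K` to `0`
on the facet. -/
lemma outerNormal_erase [DecidableEq (Space d)] (hd : 1 ≤ d) (i : K) :
    outerNormal K (K.erase i) = -(‖coordGrad (simplexBasis hK hc) i‖⁻¹ •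
      coordGrad (simplexBasis hK hc) i) := by
  have := nontrivial_of_card hd hc
  set b := simplexBasis hK hc with hb
  have hg := coordGrad_ne_zero b i
  have hg' := norm_pos_iff.mpr hg
  have h1 : b.coord i ((K.erase i).centroid ℝ id) = 0 := (centroid_erase_mem_facet hK hc hd i).1
  have h2 : 0 < b.coord i (K.centroid ℝ id) := by
    have h : Finset.centroid ℝ Finset.univ b = K.centroid ℝ id := Finset.centroid_univ ℝ K
    rw [← h, AffineBasis.coord_apply_centroid _ (Finset.mem_univ i)]
    exact inv_pos.mpr (Nat.cast_pos.mpr (Finset.card_pos.mpr ⟨i, Finset.mem_univ i⟩))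
  simp only [outerNormal]
  simp only [orthogonal_vectorSpan_erase hK hc hd i, ← hb]
  rw [Submodule.starProjection_singleton, inner_coordGrad_sub, h1, zero_sub]
  set t := b.coord i (K.centroid ℝ id)
  simp only [RCLike.ofReal_real_eq_id, id]
  rw [norm_smul, Real.norm_eq_abs, abs_div, abs_neg, abs_of_pos h2,
    abs_of_pos (by positivity : 0 < ‖coordGrad b i‖ ^ 2), smul_smul, ← neg_smul]
  congr 1
  field_simp

lemma inner_outerNormal [DecidableEq (Space d)] (hd : 1 ≤ d) (i : K) (x y : Space d) :
    ⟪y - x, outerNormal K (K.erase i)⟫ =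
      ‖coordGrad (simplexBasis hK hc) i‖⁻¹ *
        ((simplexBasis hK hc).coord i x - (simplexBasis hK hc).coord i y) := by
  rw [outerNormal_erase hK hc hd, inner_neg_right, real_inner_smul_right, real_inner_comm,
    inner_coordGrad_sub]
  ring

lemma norm_outerNormal [DecidableEq (Space d)] (hK : AffineIndependent ℝ ((↑) : K → Space d))
    (hc : K.card = d + 1) (hd : 1 ≤ d) (i : K) :
    ‖outerNormal K (K.erase i)‖ = 1 := by
  have := nontrivial_of_card hd hc
  rw [outerNormal_erase hK hc hd, norm_neg, norm_smul, norm_inv, norm_norm,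
    inv_mul_cancel₀ (norm_ne_zero_iff.mpr (coordGrad_ne_zero _ i))]

/-- Near a point in the relative interior of a facet a simplex is a half-space. -/
lemma exists_ball_mem_convexHull_iff [DecidableEq (Space d)] (hd : 1 ≤ d) (i : K) {x : Space d}
    (hx : (simplexBasis hK hc).coord i x = 0)
    (hpos : ∀ j ≠ i, 0 < (simplexBasis hK hc).coord j x) :
    ∃ r > 0, ∀ y ∈ Metric.ball x r, y ∈ convexHull ℝ (K : Set (Space d)) ↔
      ⟪y - x, outerNormal K (K.erase i)⟫ ≤ 0 := by
  have := nontrivial_of_card hd hc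
  set b := simplexBasis hK hc with hb
  have hev : ∀ᶠ y in 𝓝 x, ∀ j, j ≠ i → 0 < b.coord j y := by
    rw [eventually_all]
    intro j
    by_cases hj : j = i
    · exact Eventually.of_forall fun y h => absurd hj h
    · filter_upwards [(continuous_coord b j).continuousAt.eventually (Ioi_mem_nhds (hpos j hj))]
        with y hy _ using hy
  obtain ⟨r, hr, hball⟩ := Metric.eventually_nhds_iff_ball.mp hev
  refine ⟨r, hr, fun y hy => ?_⟩
  have hg : 0 < ‖coordGrad b i‖⁻¹ := inv_pos.mpr (norm_pos_iff.mpr (coordGrad_ne_zero b i))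
  rw [← range_simplexBasis hK hc, AffineBasis.convexHull_eq_nonneg_coord,
    inner_outerNormal hK hc hd, ← hb, hx, zero_sub, mul_neg, neg_nonpos, mul_nonneg_iff_of_pos_left hg]
  refine ⟨fun h => h i, fun h j => ?_⟩
  by_cases hj : j = i
  · rw [hj]; exact h
  · exact (hball y hy j hj).le

end SimplexGeometry

/-! ### Interior and boundary facets of a conforming mesh -/

namespace Mesh

variable {d : ℕ} {Ω : Set (Space d)} (T : Mesh Ω)

lemma mem_elements {K : Finset (Space d)} : K ∈ T.elements ↔ K ∈ T.faces ∧ K.card = d + 1 := by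
  simp [elements]

lemma indep_of_mem_elements {K : Finset (Space d)} (hK : K ∈ T.elements) :
    AffineIndependent ℝ ((↑) : K → Space d) := T.indep (T.mem_elements.mp hK).1

lemma card_of_mem_elements {K : Finset (Space d)} (hK : K ∈ T.elements) : K.card = d + 1 :=
  (T.mem_elements.mp hK).2

lemma mem_closure_iff {x : Space d} :
    x ∈ closure Ω ↔ ∃ K ∈ T.elements, x ∈ convexHull ℝ (K : Set (Space d)) := by
  rw [← T.space_eq, Geometry.SimplicialComplex.mem_space_iff]
  constructor
  · rintro ⟨s, hs, hx⟩
    obtain ⟨t, ht, hst, hc⟩ := T.pure s hs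
    exact ⟨t, T.mem_elements.mpr ⟨ht, hc⟩, convexHull_mono (Finset.coe_subset.mpr hst) hx⟩
  · rintro ⟨K, hK, hx⟩
    exact ⟨K, (T.mem_elements.mp hK).1, hx⟩

lemma convexHull_subset_closure {K : Finset (Space d)} (hK : K ∈ T.elements) :
    convexHull ℝ (K : Set (Space d)) ⊆ closure Ω :=
  fun _ hx => T.mem_closure_iff.mpr ⟨K, hK, hx⟩

lemma interior_convexHull_subset (hΩ : IsPolygonalDomain Ω) {K : Finset (Space d)}
    (hK : K ∈ T.elements) : interior (convexHull ℝ (K : Set (Space d))) ⊆ Ω := by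
  rw [← hΩ.interior_closure]
  exact interior_mono (T.convexHull_subset_closure hK)

/-- The exterior normals of two different elements on a common facet are opposite. -/
lemma outerNormal_eq_neg (hd : 1 ≤ d) {K L e : Finset (Space d)} (hK : K ∈ T.elements)
    (hL : L ∈ T.elements) (hKL : K ≠ L) (he : e.card = d) (heK : e ⊆ K) (heL : e ⊆ L) :
    outerNormal L e = -outerNormal K e := by
  classical
  have iK := T.indep_of_mem_elements hK
  have cK := T.card_of_mem_elements hK
  have iL := T.indep_of_mem_elements hL
  have cL := T.card_of_mem_elements hL
  obtain ⟨i, hi⟩ := exists_eq_erase heK he cK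
  obtain ⟨j, hj⟩ := exists_eq_erase heL he cL
  have nK : ‖outerNormal K e‖ = 1 := hi ▸ norm_outerNormal iK cK hd i
  have nL : ‖outerNormal L e‖ = 1 := hj ▸ norm_outerNormal iL cL hd j
  have hspan : (ℝ ∙ coordGrad (simplexBasis iK cK) i) = ℝ ∙ coordGrad (simplexBasis iL cL) j := by
    rw [← orthogonal_vectorSpan_erase iK cK hd i, ← orthogonal_vectorSpan_erase iL cL hd j,
      ← hi, ← hj]
  have hLmem : outerNormal L e ∈ ℝ ∙ coordGrad (simplexBasis iK cK) i := by
    rw [hspan, hj, outerNormal_erase iL cL hd j]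
    exact neg_mem (Submodule.smul_mem _ _ (Submodule.mem_span_singleton_self _))
  obtain ⟨c, hc⟩ : ∃ c : ℝ, c • outerNormal K e = outerNormal L e := by
    have hntK := nontrivial_of_card hd cK
    obtain ⟨a, ha⟩ := Submodule.mem_span_singleton.mp hLmem
    refine ⟨-(a * ‖coordGrad (simplexBasis iK cK) i‖), ?_⟩
    have := norm_ne_zero_iff.mpr (coordGrad_ne_zero (simplexBasis iK cK) i)
    rw [← ha]
    nth_rewrite 1 [hi]
    rw [outerNormal_erase iK cK hd i, smul_neg, neg_smul, neg_neg, smul_smul, mul_assoc,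
      mul_inv_cancel₀ this, mul_one]
  have hc1 : |c| = 1 := by
    have := congrArg norm hc
    rwa [norm_smul, nK, nL, mul_one, Real.norm_eq_abs] at this
  rcases (abs_eq zero_le_one).mp hc1 with h | h
  -- Equal normals would put both elements on the same side of `e`. A point slightly inside, below
  -- the barycentre of `e`, would lie in both, hence by conformity in the convex hull of `K ∩ L =
  -- e`, although its height over `e` is nonzero.
  · exfalso
    rw [h, one_smul] at hc
    have hx1 := fun k (hk : k ≠ i) => coord_centroid_erase iK cK i hk
    have hx2 := fun k (hk : k ≠ j) => coord_centroid_erase iL cL j hk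
    have hx3 := (centroid_erase_mem_facet iK cK hd i).1
    have hx4 := (centroid_erase_mem_facet iL cL hd j).1
    obtain ⟨r, hr, hball⟩ := exists_ball_mem_convexHull_iff iK cK hd i hx3 hx1
    obtain ⟨s, hs, hball'⟩ := exists_ball_mem_convexHull_iff iL cL hd j hx4 hx2
    rw [← hi] at hball hx3
    rw [← hj] at hball'
    set x := e.centroid ℝ id
    set m := min r s / 2 with hm
    have hm0 : 0 < m := by positivity
    have hmr : m < r := by have := min_le_left r s; have := lt_min hr hs; linarith
    have hms : m < s := by have := min_le_right r s; have := lt_min hr hs; linarith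
    set y := x - m • outerNormal K e with hy
    have hyx : y - x = -(m • outerNormal K e) := by rw [hy]; abel
    have hdist : dist y x = m := by
      rw [dist_eq_norm, hyx, norm_neg, norm_smul, nK, mul_one, Real.norm_of_nonneg hm0.le]
    have hinner : ⟪y - x, outerNormal K e⟫ = -m := by
      rw [hyx, inner_neg_left, real_inner_smul_left, real_inner_self_eq_norm_sq, nK]
      ring
    have hyK := (hball y (by rwa [Metric.mem_ball, hdist])).mpr (by rw [hinner]; linarith)
    have hyL := (hball' y (by rwa [Metric.mem_ball, hdist])).mpr (by rw [← hc, hinner]; linarith)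
    have hmem := T.inter_subset_convexHull (T.mem_elements.mp hK).1 (T.mem_elements.mp hL).1
      ⟨hyK, hyL⟩
    have hKLe : e = K ∩ L := by
      refine Finset.eq_of_subset_of_card_le (Finset.subset_inter heK heL) ?_
      by_contra hlt
      have h1 : K ∩ L = K := Finset.eq_of_subset_of_card_le Finset.inter_subset_left (by omega)
      have h2 : K ∩ L = L := Finset.eq_of_subset_of_card_le Finset.inter_subset_right (by omega)
      exact hKL (h1.symm.trans h2)
    rw [← Finset.coe_inter, ← hKLe, hi, convexHull_erase_eq_facet iK cK i] at hmem
    have hfin := inner_outerNormal iK cK hd i x y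
    rw [hx3, hmem.1, ← hi, hinner] at hfin
    simp only [sub_zero, mul_zero] at hfin
    linarith
  · rw [← hc, h, neg_one_smul]

/-- Three distinct elements on one facet would have pairwise opposite unit normals, which is
impossible. -/
lemma eq_or_eq_of_subset (hd : 1 ≤ d) {K L M e : Finset (Space d)} (hK : K ∈ T.elements)
    (hL : L ∈ T.elements) (hM : M ∈ T.elements) (hKL : K ≠ L) (he : e.card = d) (heK : e ⊆ K)
    (heL : e ⊆ L) (heM : e ⊆ M) : M = K ∨ M = L := by
  classical
  by_contra! h
  have h1 := T.outerNormal_eq_neg hd hK hL hKL he heK heL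
  have h2 := T.outerNormal_eq_neg hd hM hK h.1 he heM heK
  have h3 := T.outerNormal_eq_neg hd hM hL h.2 he heM heL
  obtain ⟨i, hi⟩ := exists_eq_erase heK he (T.card_of_mem_elements hK)
  have nK : ‖outerNormal K e‖ = 1 :=
    hi ▸ norm_outerNormal (T.indep_of_mem_elements hK) (T.card_of_mem_elements hK) hd i
  rw [← h2, h1] at h3
  have h4 : (2 : ℝ) • outerNormal K e = 0 := by
    rw [two_smul]
    nth_rewrite 1 [← h3]
    exact neg_add_cancel _
  have h0 : outerNormal K e = 0 := (smul_eq_zero.mp h4).resolve_left two_ne_zero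
  rw [h0, norm_zero] at nK
  exact zero_ne_one nK

/-- On a facet contained in a single element, the exterior normal of the element is the outward
normal of the domain. -/
lemma isOutwardNormal_of_boundary [DecidableEq (Space d)] (hd : 1 ≤ d) (hΩ : IsPolygonalDomain Ω)
    {K : Finset (Space d)} (hK : K ∈ T.elements) (i : K)
    (hbd : ∀ L ∈ T.elements, K.erase (i : Space d) ⊆ L → L = K) {x : Space d}
    (hx : (simplexBasis (T.indep_of_mem_elements hK) (T.card_of_mem_elements hK)).coord i x = 0)
    (hpos : ∀ j ≠ i, 0 <
      (simplexBasis (T.indep_of_mem_elements hK) (T.card_of_mem_elements hK)).coord j x) :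
    IsOutwardNormal Ω x (outerNormal K (K.erase i)) := by
  have iK := T.indep_of_mem_elements hK
  have cK := T.card_of_mem_elements hK
  set n := outerNormal K (K.erase i)
  have hn : ‖n‖ = 1 := norm_outerNormal iK cK hd i
  refine ⟨hn, ?_⟩
  have hxK : x ∈ convexHull ℝ (K : Set (Space d)) := by
    rw [← range_simplexBasis iK cK, AffineBasis.convexHull_eq_nonneg_coord]
    intro j
    by_cases hj : j = i
    · rw [hj, hx]
    · exact (hpos j hj).le
  -- Another element `L` misses some vertex `v ≠ i` of `K`. By conformity a common point `x` would
  -- lie in the hull of `K ∩ L`, so its `v`-th coordinate would vanish.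
  have hnot : ∀ L ∈ T.elements.erase K, x ∉ convexHull ℝ (L : Set (Space d)) := by
    intro L hL hxL
    obtain ⟨hLK, hL⟩ := Finset.mem_erase.mp hL
    obtain ⟨v, hv, hvL⟩ := Finset.not_subset.mp fun h => hLK (hbd L hL h)
    obtain ⟨hvi, hvK⟩ := Finset.mem_erase.mp hv
    have h1 := T.inter_subset_convexHull (T.mem_elements.mp hK).1 (T.mem_elements.mp hL).1
      ⟨hxK, hxL⟩
    have h2 : (K ∩ L : Set (Space d)) ⊆ (K.erase v : Finset (Space d)) := fun w hw =>
      Finset.mem_coe.mpr (Finset.mem_erase.mpr ⟨fun h => hvL (h ▸ hw.2), hw.1⟩)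
    have h3 := convexHull_mono (𝕜 := ℝ) h2 h1
    have h4 := convexHull_erase_eq_facet iK cK ⟨v, hvK⟩
    rw [h4] at h3
    exact (hpos ⟨v, hvK⟩ fun h => hvi (congrArg Subtype.val h)).ne' h3.1
  have hclosed : IsClosed (⋃ L ∈ T.elements.erase K, convexHull ℝ (L : Set (Space d))) :=
    Set.Finite.isClosed_biUnion (Finset.finite_toSet _)
      fun L _ => (L.finite_toSet.isCompact_convexHull ℝ).isClosed
  obtain ⟨s, hs, hball'⟩ := Metric.isOpen_iff.mp hclosed.isOpen_compl x (by simpa using hnot)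
  obtain ⟨r, hr, hball⟩ := exists_ball_mem_convexHull_iff iK cK hd i hx hpos
  have hcl : ∀ y ∈ Metric.ball x (min r s), y ∈ closure Ω ↔ ⟪y - x, n⟫ ≤ 0 := by
    intro y hy
    rw [← hball y (Metric.ball_subset_ball (min_le_left _ _) hy), T.mem_closure_iff]
    refine ⟨?_, fun h => ⟨K, hK, h⟩⟩
    rintro ⟨L, hL, hyL⟩
    by_cases hLK : L = K
    · rwa [← hLK]
    · refine absurd ?_ (hball' (Metric.ball_subset_ball (min_le_right _ _) hy))
      exact Set.mem_biUnion (Finset.mem_coe.mpr (Finset.mem_erase.mpr ⟨hLK, hL⟩)) hyL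
  refine ⟨min r s, lt_min hr hs, ?_⟩
  ext y
  simp only [Set.mem_inter_iff, Set.mem_ofPred_eq]
  rw [and_comm, and_congr_right_iff]
  intro hy
  constructor
  -- A point of `Ω` on the hyperplane could be moved a little along `n` without leaving `Ω`, yet it
  -- would leave the closed half-space that `closure Ω` is near `x`.
  · intro hyΩ
    refine lt_of_le_of_ne ((hcl y hy).mp (subset_closure hyΩ)) fun h0 => ?_
    have hev : ∀ᶠ t : ℝ in 𝓝 0, y + t • n ∈ Ω ∩ Metric.ball x (min r s) := by
      have hcont : Continuous fun t : ℝ => y + t • n := by fun_prop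
      refine hcont.continuousAt.eventually ?_
      simp only [zero_smul, add_zero]
      exact (hΩ.isOpen.inter Metric.isOpen_ball).mem_nhds ⟨hyΩ, hy⟩
    obtain ⟨t, ht, ht0⟩ := ((hev.filter_mono nhdsWithin_le_nhds).and
      (self_mem_nhdsWithin (a := (0 : ℝ)) (s := Set.Ioi 0))).exists
    have h1 := (hcl _ ht.2).mp (subset_closure ht.1)
    have h2 : ⟪y + t • n - x, n⟫ = t := by
      rw [add_sub_right_comm, inner_add_left, h0, real_inner_smul_left,
        real_inner_self_eq_norm_sq, hn]
      ring
    rw [h2] at h1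
    exact absurd h1 (not_le.mpr ht0)
  -- The open half-ball lies in `closure Ω`; the absence of cracks, `interior (closure Ω) = Ω`, puts
  -- it in `Ω`.
  · intro hlt
    rw [← hΩ.interior_closure, mem_interior]
    refine ⟨{z | ⟪z - x, n⟫ < 0} ∩ Metric.ball x (min r s),
      fun z hz => (hcl z hz.2).mpr (le_of_lt hz.1), ?_, hlt, hy⟩
    exact (isOpen_lt (by fun_prop) continuous_const).inter Metric.isOpen_ball

end Mesh

/-! ### Upwind systems on a finite graph -/

section UpwindSystem

variable {E J : Type*} [Fintype E] [Fintype J] {k l : J → E} {P N : J → ℝ} {m : E → ℝ}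

/-- The weak form of an upwind finite volume system on a finite graph: `m` are the weighted cell
volumes, and `P`, `N` the outgoing and incoming fluxes of the edge `j` from `k j` to `l j`. -/
def IsUpwindSolution (k l : J → E) (P N : J → ℝ) (m c c' : E → ℝ) : Prop :=
  ∀ w : E → ℝ, ∑ i, m i * (c' i - c i) * w i +
    ∑ j, (P j * c' (k j) - N j * c' (l j)) * (w (k j) - w (l j)) = 0

lemma IsUpwindSolution.neg {c c' : E → ℝ} (h : IsUpwindSolution k l P N m c c') :
    IsUpwindSolution k l P N m (-c) (-c') := by
  intro w
  have := h (-w)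
  rw [← this]
  congr 1 <;> refine Finset.sum_congr rfl fun i _ => ?_ <;> simp only [Pi.neg_apply] <;> ring

/-- Test with the indicator of a cell `i₀` maximizing `c'`, and subtract `c' i₀` times the flux
balance. An edge leaving `i₀` contributes `N j * (c' i₀ - c' (l j))`, an edge entering it `P j * (c'
i₀ - c' (k j))`; both are nonnegative. -/
lemma IsUpwindSolution.le (hkl : ∀ j, k j ≠ l j) (hP : ∀ j, 0 ≤ P j) (hN : ∀ j, 0 ≤ N j)
    (hm : ∀ i, 0 < m i) (hflux : ∀ w : E → ℝ, ∑ j, (P j - N j) * (w (k j) - w (l j)) = 0)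
    {c c' : E → ℝ} (h : IsUpwindSolution k l P N m c c') {M : ℝ} (hM : ∀ i, c i ≤ M) (i : E) :
    c' i ≤ M := by
  classical
  have : Nonempty E := ⟨i⟩
  obtain ⟨i₀, hi₀⟩ := Finite.exists_max c'
  refine (hi₀ i).trans (le_trans ?_ (hM i₀))
  have h1 := h (Pi.single i₀ 1)
  have h2 := hflux (Pi.single i₀ 1)
  have h3 : 0 ≤ ∑ j, (P j * c' (k j) - N j * c' (l j)) *
      ((Pi.single i₀ 1 : E → ℝ) (k j) - (Pi.single i₀ 1 : E → ℝ) (l j)) -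
      c' i₀ * ∑ j, (P j - N j) *
        ((Pi.single i₀ 1 : E → ℝ) (k j) - (Pi.single i₀ 1 : E → ℝ) (l j)) := by
    rw [Finset.mul_sum, ← Finset.sum_sub_distrib]
    refine Finset.sum_nonneg fun j _ => ?_
    have hPj := mul_nonneg (hP j) (sub_nonneg.mpr (hi₀ (k j)))
    have hNj := mul_nonneg (hN j) (sub_nonneg.mpr (hi₀ (l j)))
    by_cases hk : k j = i₀
    · have hl : l j ≠ i₀ := fun h => hkl j (hk.trans h.symm)
      simp only [hk, Pi.single_eq_same, Pi.single_eq_of_ne hl]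
      linarith
    · by_cases hl : l j = i₀
      · simp only [hl, Pi.single_eq_same, Pi.single_eq_of_ne hk]
        linarith
      · simp only [Pi.single_eq_of_ne hk, Pi.single_eq_of_ne hl]
        linarith
  have h4 : ∑ i, m i * (c' i - c i) * (Pi.single i₀ 1 : E → ℝ) i = m i₀ * (c' i₀ - c i₀) := by
    simp [Pi.single_apply]
  rw [h4] at h1
  rw [h2, mul_zero, sub_zero] at h3
  by_contra hlt
  have := mul_pos (hm i₀) (sub_pos.mpr (not_le.mp hlt))
  linarith

lemma IsUpwindSolution.ge (hkl : ∀ j, k j ≠ l j) (hP : ∀ j, 0 ≤ P j) (hN : ∀ j, 0 ≤ N j)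
    (hm : ∀ i, 0 < m i) (hflux : ∀ w : E → ℝ, ∑ j, (P j - N j) * (w (k j) - w (l j)) = 0)
    {c c' : E → ℝ} (h : IsUpwindSolution k l P N m c c') {M : ℝ} (hM : ∀ i, M ≤ c i) (i : E) :
    M ≤ c' i :=
  neg_le_neg_iff.mp (h.neg.le hkl hP hN hm hflux (fun i => neg_le_neg (hM i)) i)

lemma IsUpwindSolution.sub {c₁ c₁' c₂ c₂' : E → ℝ} (h₁ : IsUpwindSolution k l P N m c₁ c₁')
    (h₂ : IsUpwindSolution k l P N m c₂ c₂') :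
    IsUpwindSolution k l P N m (c₁ - c₂) (c₁' - c₂') := by
  intro w
  have h := congrArg₂ (· - ·) (h₁ w) (h₂ w)
  simp only [sub_zero] at h
  rw [← h, add_sub_add_comm, ← Finset.sum_sub_distrib, ← Finset.sum_sub_distrib]
  congr 1 <;> refine Finset.sum_congr rfl fun i _ => ?_ <;> simp only [Pi.sub_apply] <;> ring

lemma IsUpwindSolution.unique (hkl : ∀ j, k j ≠ l j) (hP : ∀ j, 0 ≤ P j) (hN : ∀ j, 0 ≤ N j)
    (hm : ∀ i, 0 < m i) (hflux : ∀ w : E → ℝ, ∑ j, (P j - N j) * (w (k j) - w (l j)) = 0)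
    {c c₁ c₂ : E → ℝ} (h₁ : IsUpwindSolution k l P N m c c₁)
    (h₂ : IsUpwindSolution k l P N m c c₂) : c₁ = c₂ := by
  have h := h₁.sub h₂
  ext i
  have h3 := h.le hkl hP hN hm hflux (M := 0) (fun i => by simp) i
  have h4 := h.ge hkl hP hN hm hflux (M := 0) (fun i => by simp) i
  exact sub_eq_zero.mp (le_antisymm h3 h4)

/-- The system is square, so injectivity, which `IsUpwindSolution.unique` supplies, gives
surjectivity. -/
lemma exists_isUpwindSolution (hkl : ∀ j, k j ≠ l j) (hP : ∀ j, 0 ≤ P j) (hN : ∀ j, 0 ≤ N j)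
    (hm : ∀ i, 0 < m i) (hflux : ∀ w : E → ℝ, ∑ j, (P j - N j) * (w (k j) - w (l j)) = 0)
    (c : E → ℝ) : ∃ c', IsUpwindSolution k l P N m c c' := by
  classical
  let A : (E → ℝ) →ₗ[ℝ] (E → ℝ) :=
    { toFun := fun c' i => m i * c' i + ∑ j, (P j * c' (k j) - N j * c' (l j)) *
        ((Pi.single i 1 : E → ℝ) (k j) - (Pi.single i 1 : E → ℝ) (l j))
      map_add' := fun x y => by
        ext i
        simp only [Pi.add_apply]
        rw [add_add_add_comm, ← Finset.sum_add_distrib, mul_add]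
        congr 1
        exact Finset.sum_congr rfl fun j _ => by ring
      map_smul' := fun a x => by
        ext i
        simp only [Pi.smul_apply, smul_eq_mul, RingHom.id_apply]
        rw [mul_add, Finset.mul_sum]
        congr 1
        · ring
        · exact Finset.sum_congr rfl fun j _ => by ring }
  -- Row `i` of `A` is the weak form tested with `Pi.single i 1`; a general test function is
  -- recovered by summing the rows against `w`.
  have hA : ∀ c c' : E → ℝ, A c' = m * c → IsUpwindSolution k l P N m c c' := by
    intro c c' h w
    have h1 : ∀ i, m i * (c' i - c i) * w i = -∑ j, (P j * c' (k j) - N j * c' (l j)) *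
        ((Pi.single i 1 : E → ℝ) (k j) - (Pi.single i 1 : E → ℝ) (l j)) * w i := fun i => by
      have h2 : m i * c' i + _ = m i * c i := congrFun h i
      rw [← Finset.sum_mul, mul_sub, ← h2]
      ring
    have h3 : ∀ j, ∑ i, (P j * c' (k j) - N j * c' (l j)) *
        ((Pi.single i 1 : E → ℝ) (k j) - (Pi.single i 1 : E → ℝ) (l j)) * w i =
        (P j * c' (k j) - N j * c' (l j)) * (w (k j) - w (l j)) := fun j => by
      simp_rw [mul_assoc]
      rw [← Finset.mul_sum]
      simp [sub_mul, Pi.single_apply]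
    simp_rw [h1]
    rw [Finset.sum_neg_distrib, Finset.sum_comm]
    simp_rw [h3]
    exact neg_add_cancel _
  have hinj : Function.Injective A := by
    rw [← LinearMap.ker_eq_bot, LinearMap.ker_eq_bot']
    intro x hx
    exact (hA 0 x (by rw [hx, mul_zero])).unique hkl hP hN hm hflux
      (hA 0 0 (by rw [map_zero, mul_zero]))
  obtain ⟨c', hc'⟩ := (LinearMap.injective_iff_surjective.mp hinj) (m * c)
  exact ⟨c', hA c c' hc'⟩

end UpwindSystem

/-! ### Flux balance on the mesh and reduction of the scheme to a graph system -/

namespace Mesh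

variable {d : ℕ} {Ω : Set (Space d)} (T : Mesh Ω)

/-- The flux of `β` through the facet `e` of `K`, out of `K`. -/
noncomputable def flux (β : Space d → Space d) (K e : Finset (Space d)) : ℝ :=
  ∫ x in convexHull ℝ (e : Set (Space d)), ⟪β x, outerNormal K e⟫ ∂μHE[d - 1]

/-- Tietze extension: `β` is continuous only on `closure Ω`, while the layer argument uses a field
continuous everywhere. -/
lemma exists_continuous_eqOn {s : Set (Space d)} (hs : IsClosed s) {β : Space d → Space d}
    (hβ : ContinuousOn β s) : ∃ F : Space d → Space d, Continuous F ∧ Set.EqOn F β s := by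
  obtain ⟨F, hF⟩ := ContinuousMap.exists_restrict_eq hs
    (⟨s.domRestrict β, hβ.domRestrict⟩ : C(s, Space d))
  exact ⟨F, F.continuous, fun x hx => congrArg (fun f : C(s, Space d) => f ⟨x, hx⟩) hF⟩

lemma convexHull_subset_closure_of_subset {K e : Finset (Space d)} (hK : K ∈ T.elements)
    (he : e ⊆ K) : convexHull ℝ (e : Set (Space d)) ⊆ closure Ω :=
  (convexHull_mono (Finset.coe_subset.mpr he)).trans (T.convexHull_subset_closure hK)

/-- The interior of an element lies in `Ω`, so test functions supported there are admissible for
`Incompressible`. The sign changes because coordinate gradients point inwards. -/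
theorem sum_flux_eq_zero [DecidableEq (Space d)] (hd : 1 ≤ d) (hΩ : IsPolygonalDomain Ω)
    {β : Space d → Space d} (hβ : ContinuousOn β (closure Ω)) (hdiv : Incompressible Ω β)
    {K : Finset (Space d)} (hK : K ∈ T.elements) :
    ∑ i : K, flux β K (K.erase i) = 0 := by
  obtain ⟨F, hF, hFβ⟩ := exists_continuous_eqOn isClosed_closure hβ
  have iK := T.indep_of_mem_elements hK
  have cK := T.card_of_mem_elements hK
  have := nontrivial_of_card hd cK
  have h := sum_integral_facet_eq_zero (simplexBasis iK cK) hF fun φ h1 h2 h3 => by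
    have hsub : tsupport φ ⊆ Ω := by
      rw [range_simplexBasis] at h3
      exact h3.trans (T.interior_convexHull_subset hΩ hK)
    rw [← hdiv φ h1 h2 hsub, ← setIntegral_eq_integral_of_forall_compl_eq_zero (s := Ω)]
    · exact setIntegral_congr_fun hΩ.isOpen.measurableSet fun x hx => by
        simp only [hFβ (subset_closure hx)]
    · intro x hx
      have h4 : gradient φ x = 0 := by
        rw [gradient, image_eq_zero_of_notMem_tsupport
          fun h => hx (hsub (tsupport_fderiv_subset ℝ h)), map_zero]
      rw [h4, inner_zero_right]
  rw [finrank_euclideanSpace_fin] at h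
  rw [← neg_eq_zero, ← h, ← Finset.sum_neg_distrib]
  refine Finset.sum_congr rfl fun i _ => ?_
  rw [flux, ← integral_neg, convexHull_erase_eq_facet iK cK i]
  refine setIntegral_congr_fun (isCompact_facet _ i).isClosed.measurableSet fun x hx => ?_
  have hx' : x ∈ closure Ω := by
    rw [← convexHull_erase_eq_facet iK cK i] at hx
    exact T.convexHull_subset_closure_of_subset hK (Finset.erase_subset _ _) hx
  simp only [hFβ hx', outerNormal_erase iK cK hd i, inner_neg_right, neg_neg]

/-- The slip condition applies only in the relative interior of the facet. Any other point is
reached along the segment to the barycentre, and continuity carries the zero over. -/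
theorem flux_eq_zero_of_boundary [DecidableEq (Space d)] (hd : 1 ≤ d) (hΩ : IsPolygonalDomain Ω)
    {β : Space d → Space d} (hβ : ContinuousOn β (closure Ω)) (hslip : SlipCondition Ω β)
    {K : Finset (Space d)} (hK : K ∈ T.elements) (i : K)
    (hbd : ∀ L ∈ T.elements, K.erase (i : Space d) ⊆ L → L = K) :
    flux β K (K.erase i) = 0 := by
  obtain ⟨F, hF, hFβ⟩ := exists_continuous_eqOn isClosed_closure hβ
  have iK := T.indep_of_mem_elements hK
  have cK := T.card_of_mem_elements hK
  set n := outerNormal K (K.erase i) with hn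
  have hsub := T.convexHull_subset_closure_of_subset hK (Finset.erase_subset (i : Space d) K)
  refine setIntegral_eq_zero_of_forall_eq_zero fun x hx => ?_
  set c := (K.erase (i : Space d)).centroid ℝ id
  have hc0 := (centroid_erase_mem_facet iK cK hd i).1
  have hcpos := fun j (hj : j ≠ i) => coord_centroid_erase iK cK i hj
  have hxf := hx
  rw [convexHull_erase_eq_facet iK cK i] at hxf
  have hcf := centroid_erase_mem_facet iK cK hd i
  rw [← convexHull_erase_eq_facet iK cK i] at hcf
  have hzero : ∀ t ∈ Set.Ioc (0 : ℝ) 1, ⟪F (AffineMap.lineMap x c t), n⟫ = 0 := by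
    intro t ht
    have hmem : AffineMap.lineMap x c t ∈ convexHull ℝ (K.erase i : Set (Space d)) :=
      (convex_convexHull ℝ _).lineMap_mem hx hcf ⟨ht.1.le, ht.2⟩
    rw [hFβ (hsub hmem)]
    refine hslip _ _ (T.isOutwardNormal_of_boundary hd hΩ hK i hbd ?_ fun j hj => ?_)
    · rw [AffineMap.apply_lineMap, hxf.1, hc0, AffineMap.lineMap_same_apply]
    · rw [AffineMap.apply_lineMap, AffineMap.lineMap_apply_module]
      have h1 := mul_pos ht.1 (hcpos j hj)
      have h2 := mul_nonneg (sub_nonneg.mpr ht.2) (hxf.2 j)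
      simp only [smul_eq_mul]
      exact add_pos_of_nonneg_of_pos h2 h1
  have hcont : Continuous fun t : ℝ => ⟪F (AffineMap.lineMap x c t), n⟫ :=
    (hF.comp AffineMap.lineMap_continuous).inner continuous_const
  have hlim := (hcont.tendsto 0).mono_left (nhdsWithin_le_nhds (s := Set.Ioi 0))
  have hlim0 : Tendsto (fun t : ℝ => ⟪F (AffineMap.lineMap x c t), n⟫) (𝓝[>] 0) (𝓝 0) := by
    refine tendsto_const_nhds.congr' ?_
    filter_upwards [Ioc_mem_nhdsGT zero_lt_one] with t ht using (hzero t ht).symm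
  have h := tendsto_nhds_unique hlim hlim0
  simpa [hFβ (hsub hx)] using h

lemma mem_interiorEdges {e : Finset (Space d)} : e ∈ T.interiorEdges ↔ e ∈ T.faces ∧ e.card = d ∧
    ∃ K ∈ T.elements, ∃ L ∈ T.elements, K ≠ L ∧ e ⊆ K ∧ e ⊆ L := by
  simp [interiorEdges]

/-- The total flux out of an element through the interior edges vanishes. -/
lemma sum_interior_flux_eq_zero (hd : 1 ≤ d) (hΩ : IsPolygonalDomain Ω)
    {β : Space d → Space d} (hβ : ContinuousOn β (closure Ω)) (hdiv : Incompressible Ω β)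
    (hslip : SlipCondition Ω β) {K : Finset (Space d)} (hK : K ∈ T.elements) :
    ∑ e ∈ T.interiorEdges with e ⊆ K, flux β K e = 0 := by
  classical
  have cK := T.card_of_mem_elements hK
  rw [← T.sum_flux_eq_zero hd hΩ hβ hdiv hK]
  have hinj : Set.InjOn (fun i : K => K.erase (i : Space d)) (Finset.univ : Finset K) :=
    fun i _ j _ h => Subtype.ext (Finset.erase_injOn K i.2 j.2 h)
  rw [← Finset.sum_image hinj (f := fun e => flux β K e)]
  refine Finset.sum_subset (fun e he => ?_) fun e he hne => ?_
  · obtain ⟨he1, he2⟩ := Finset.mem_filter.mp he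
    obtain ⟨i, hi⟩ := exists_eq_erase he2 (T.mem_interiorEdges.mp he1).2.1 cK
    exact Finset.mem_image.mpr ⟨i, Finset.mem_univ i, hi.symm⟩
  · obtain ⟨i, -, rfl⟩ := Finset.mem_image.mp he
    have hcard : (K.erase (i : Space d)).card = d := by
      rw [Finset.card_erase_of_mem i.2]; omega
    refine T.flux_eq_zero_of_boundary hd hΩ hβ hslip hK i fun L hL hsub => ?_
    by_contra hLK
    refine hne (Finset.mem_filter.mpr ⟨T.mem_interiorEdges.mpr ⟨?_, hcard, L, hL, K, hK, hLK,
      hsub, Finset.erase_subset _ _⟩, Finset.erase_subset _ _⟩)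
    -- Faces must be nonempty; the facet has `d ≥ 1` vertices, a single one when `d = 1`.
    exact T.down_closed (T.mem_elements.mp hK).1 (Finset.erase_subset _ _)
      (Finset.card_pos.mp (by omega))

/-- Discrete integration by parts: as the fluxes on the two sides of an edge are opposite, each jump
term splits between its two elements, and the sum regrouped by elements has zero coefficients. -/
lemma sum_flux_mul_jump_eq_zero (hd : 1 ≤ d) (hΩ : IsPolygonalDomain Ω) (O : T.Orientation)
    {β : Space d → Space d} (hβ : ContinuousOn β (closure Ω)) (hdiv : Incompressible Ω β)
    (hslip : SlipCondition Ω β) (w : T.elements → ℝ) :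
    ∑ e : T.interiorEdges, flux β (O.K e) e * (w (O.K e) - w (O.L e)) = 0 := by
  classical
  have key : ∀ e : T.interiorEdges, flux β (O.K e) e * (w (O.K e) - w (O.L e)) =
      ∑ K : T.elements, if e.1 ⊆ K.1 then flux β K e * w K else 0 := by
    intro e
    have he := (T.mem_interiorEdges.mp e.2).2.1
    have hne : (O.K e).1 ≠ (O.L e).1 := fun h => O.ne e (Subtype.ext h)
    have hneg : flux β (O.L e) e = -flux β (O.K e) e := by
      simp only [flux]
      rw [T.outerNormal_eq_neg hd (O.K e).2 (O.L e).2 hne he (O.subset_K e) (O.subset_L e)]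
      simp_rw [inner_neg_right]
      exact integral_neg _
    rw [← Finset.sum_subset (Finset.subset_univ {O.K e, O.L e}), Finset.sum_pair (O.ne e),
      if_pos (O.subset_K e), if_pos (O.subset_L e), hneg]
    · ring
    · intro M _ hM
      refine if_neg fun hsub => hM ?_
      rcases T.eq_or_eq_of_subset hd (O.K e).2 (O.L e).2 M.2 hne he (O.subset_K e)
        (O.subset_L e) hsub with h | h
      · exact Finset.mem_insert.mpr (Or.inl (Subtype.ext h))
      · exact Finset.mem_insert.mpr (Or.inr (Finset.mem_singleton.mpr (Subtype.ext h)))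
  simp_rw [key]
  rw [Finset.sum_comm]
  refine Finset.sum_eq_zero fun K _ => ?_
  rw [Finset.sum_coe_sort T.interiorEdges (fun e => if e ⊆ K.1 then flux β K e * w K else 0),
    ← Finset.sum_filter, ← Finset.sum_mul, T.sum_interior_flux_eq_zero hd hΩ hβ hdiv hslip K.2,
    zero_mul]

lemma integrableOn_inner_outerNormal (hd : 1 ≤ d) {β : Space d → Space d}
    (hβ : ContinuousOn β (closure Ω)) {K e : Finset (Space d)} (hK : K ∈ T.elements)
    (he : e ⊆ K) (hec : e.card = d) (n : Space d) :
    IntegrableOn (fun x => ⟪β x, n⟫) (convexHull ℝ (e : Set (Space d))) μHE[d - 1] := by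
  classical
  have cK := T.card_of_mem_elements hK
  have iK := T.indep_of_mem_elements hK
  have := nontrivial_of_card hd cK
  have hcomp : IsCompact (convexHull ℝ (e : Set (Space d))) :=
    e.finite_toSet.isCompact_convexHull ℝ
  have hcont : ContinuousOn (fun x => ⟪β x, n⟫) (convexHull ℝ (e : Set (Space d))) :=
    (hβ.mono (T.convexHull_subset_closure_of_subset hK he)).inner continuousOn_const
  have hfin : μHE[d - 1] (convexHull ℝ (e : Set (Space d))) < ⊤ := by
    obtain ⟨i, hi⟩ := exists_eq_erase he hec cK
    have h := hausdorffMeasure_facet_lt_top (simplexBasis iK cK) i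
    rwa [finrank_euclideanSpace_fin, ← convexHull_erase_eq_facet iK cK i, ← hi] at h
  obtain ⟨C, hC⟩ := hcomp.exists_bound_of_continuousOn hcont
  exact IntegrableOn.of_bound hfin
    (hcont.aestronglyMeasurable hcomp.isClosed.measurableSet) C
    (ae_restrict_of_forall_mem hcomp.isClosed.measurableSet hC)

/-- The piecewise constant function with given values on the elements. -/
def piecewiseConst (c : T.elements → ℝ) : T.Broken := fun K _ => c K

lemma mem_Pdisc_zero_iff {v : T.Broken} : v ∈ T.Pdisc 0 ↔ ∃ c, v = T.piecewiseConst c := by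
  constructor
  · intro hv
    choose p hp hpv using hv
    refine ⟨fun K => (p K).coeff 0, ?_⟩
    ext K x
    rw [hpv, MvPolynomial.totalDegree_eq_zero_iff_eq_C.mp (Nat.le_zero.mp (hp K))]
    simp [piecewiseConst]
  · rintro ⟨c, rfl⟩ K
    exact ⟨MvPolynomial.C (c K), by simp, fun x => by simp [piecewiseConst]⟩

/-- The flux through an interior edge in the direction of its normal. -/
noncomputable def outFlux (O : T.Orientation) (β : Space d → Space d) (e : T.interiorEdges) : ℝ :=
  ∫ x in convexHull ℝ (e.1 : Set (Space d)), max ⟪β x, outerNormal (O.K e).1 e.1⟫ 0 ∂μHE[d - 1]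

/-- The flux through an interior edge against the direction of its normal. -/
noncomputable def inFlux (O : T.Orientation) (β : Space d → Space d) (e : T.interiorEdges) : ℝ :=
  ∫ x in convexHull ℝ (e.1 : Set (Space d)), max (-⟪β x, outerNormal (O.K e).1 e.1⟫) 0 ∂μHE[d - 1]

section

variable (hd : 1 ≤ d) (O : T.Orientation) {β : Space d → Space d}
  (hβ : ContinuousOn β (closure Ω))
include hd hβ

lemma integrableOn_edge (e : T.interiorEdges) :
    IntegrableOn (fun x => ⟪β x, outerNormal (O.K e).1 e.1⟫)
      (convexHull ℝ (e.1 : Set (Space d))) μHE[d - 1] :=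
  T.integrableOn_inner_outerNormal hd hβ (O.K e).2 (O.subset_K e) (T.mem_interiorEdges.mp e.2).2.1 _

lemma outFlux_sub_inFlux (e : T.interiorEdges) :
    T.outFlux O β e - T.inFlux O β e = flux β (O.K e) e := by
  have h := T.integrableOn_edge hd O hβ e
  rw [outFlux, inFlux, ← integral_sub h.pos_part h.neg_part]
  refine integral_congr_ae (Filter.Eventually.of_forall fun x => ?_)
  rcases le_total 0 ⟪β x, outerNormal (O.K e).1 e.1⟫ with h0 | h0 <;> simp [h0]

/-- The volume term drops out since constants have zero gradient, and in the edge terms the constant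
traces leave the integrals. -/
lemma aUpw_piecewiseConst (c w : T.elements → ℝ) :
    T.aUpw O β (T.piecewiseConst c) (T.piecewiseConst w) =
      ∑ e : T.interiorEdges, (T.outFlux O β e * c (O.K e) - T.inFlux O β e * c (O.L e)) *
        (w (O.K e) - w (O.L e)) := by
  have h0 : ∀ (K : T.elements) x, gradient (T.piecewiseConst w K) x = 0 := fun K x =>
    (hasGradientAt_const x (w K)).gradient
  simp only [aUpw, h0, inner_zero_right, mul_zero, integral_zero, Finset.sum_const_zero,
    neg_zero, zero_add, piecewiseConst]
  refine Finset.sum_congr rfl fun e _ => ?_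
  have h := T.integrableOn_edge hd O hβ e
  rw [integral_mul_const, integral_sub (h.pos_part.mul_const _) (h.neg_part.mul_const _),
    integral_mul_const, integral_mul_const, outFlux, inFlux]

lemma isUpwindStep_iff {τ : ℝ} (c : T.elements → ℝ) (v' : T.Broken) :
    T.IsUpwindStep O β τ (T.piecewiseConst c) v' ↔ ∃ c', v' = T.piecewiseConst c' ∧
      IsUpwindSolution O.K O.L (T.outFlux O β) (T.inFlux O β)
        (fun K => volume.real (convexHull ℝ (K.1 : Set (Space d))) / τ) c c' := by
  have key : ∀ c' w : T.elements → ℝ,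
      (∑ K : T.elements, ∫ x in convexHull ℝ (K.1 : Set (Space d)),
        (T.piecewiseConst c' K x - T.piecewiseConst c K x) / τ * T.piecewiseConst w K x) =
      ∑ K : T.elements, volume.real (convexHull ℝ (K.1 : Set (Space d))) / τ * (c' K - c K) *
        w K := by
    intro c' w
    refine Finset.sum_congr rfl fun K _ => ?_
    simp only [piecewiseConst, setIntegral_const, smul_eq_mul]
    ring
  constructor
  · rintro ⟨hv', h⟩
    obtain ⟨c', rfl⟩ := T.mem_Pdisc_zero_iff.mp hv'
    refine ⟨c', rfl, fun w => ?_⟩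
    rw [← key, ← T.aUpw_piecewiseConst hd O hβ]
    exact h _ (T.mem_Pdisc_zero_iff.mpr ⟨w, rfl⟩)
  · rintro ⟨c', rfl, h⟩
    refine ⟨T.mem_Pdisc_zero_iff.mpr ⟨c', rfl⟩, fun w hw => ?_⟩
    obtain ⟨w, rfl⟩ := T.mem_Pdisc_zero_iff.mp hw
    rw [key, T.aUpw_piecewiseConst hd O hβ]
    exact h w

end

lemma volume_real_pos {K : Finset (Space d)} (hK : K ∈ T.elements) :
    0 < volume.real (convexHull ℝ (K : Set (Space d))) := by
  refine ENNReal.toReal_pos ?_ (K.finite_toSet.isCompact_convexHull ℝ).measure_lt_top.ne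
  refine (Measure.measure_pos_of_nonempty_interior volume ?_).ne'
  rw [← range_simplexBasis (T.indep_of_mem_elements hK) (T.card_of_mem_elements hK)]
  exact ⟨_, AffineBasis.centroid_mem_interior_convexHull _⟩

lemma convexHull_nonempty (K : T.elements) : (convexHull ℝ (K.1 : Set (Space d))).Nonempty :=
  convexHull_nonempty_iff.mpr
    (Finset.coe_nonempty.mpr (T.nonempty_of_mem_faces (T.mem_elements.mp K.2).1))

lemma elements_nonempty (hΩ : IsPolygonalDomain Ω) : Nonempty T.elements := by
  obtain ⟨x, hx⟩ := hΩ.isConnected.nonempty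
  obtain ⟨K, hK, -⟩ := T.mem_closure_iff.mp (subset_closure hx)
  exact ⟨⟨K, hK⟩⟩

lemma values_piecewiseConst (c : T.elements → ℝ) : T.values (T.piecewiseConst c) = Set.range c := by
  ext r
  constructor
  · rintro ⟨K, x, -, h⟩
    exact ⟨K, h⟩
  · rintro ⟨K, h⟩
    obtain ⟨x, hx⟩ := T.convexHull_nonempty K
    exact ⟨K, x, hx, h⟩

end Mesh

end UpwindDG

theorem mainTheorem6 {d : ℕ} (hd : 1 ≤ d) {Ω : Set (UpwindDG.Space d)}
    (hΩ : UpwindDG.IsPolygonalDomain Ω) (T : UpwindDG.Mesh Ω) (O : T.Orientation)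
    {β : UpwindDG.Space d → UpwindDG.Space d} (hβ : ContinuousOn β (closure Ω))
    (hdiv : UpwindDG.Incompressible Ω β) (hslip : UpwindDG.SlipCondition Ω β)
    {τ : ℝ} (hτ : 0 < τ) {v : T.Broken} (hv : v ∈ T.Pdisc 0) :
    (∃! v' : T.Broken, T.IsUpwindStep O β τ v v') ∧
    ∀ v' : T.Broken, T.IsUpwindStep O β τ v v' →
      ∃ a b : ℝ, IsLeast (T.values v) a ∧ IsGreatest (T.values v) b ∧
        ∀ K : T.elements, ∀ x ∈ convexHull ℝ (K.1 : Set (UpwindDG.Space d)),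
          a ≤ v' K x ∧ v' K x ≤ b := by
  obtain ⟨c, rfl⟩ := T.mem_Pdisc_zero_iff.mp hv
  have hP : ∀ e, 0 ≤ T.outFlux O β e := fun e => integral_nonneg fun x => le_max_right _ _
  have hN : ∀ e, 0 ≤ T.inFlux O β e := fun e => integral_nonneg fun x => le_max_right _ _
  have hm : ∀ K : T.elements,
      0 < volume.real (convexHull ℝ (K.1 : Set (UpwindDG.Space d))) / τ := fun K =>
    div_pos (T.volume_real_pos K.2) hτ
  have hflux : ∀ w : T.elements → ℝ,
      ∑ e, (T.outFlux O β e - T.inFlux O β e) * (w (O.K e) - w (O.L e)) = 0 := fun w => by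
    simp_rw [T.outFlux_sub_inFlux hd O hβ]
    exact T.sum_flux_mul_jump_eq_zero hd hΩ O hβ hdiv hslip w
  simp_rw [T.isUpwindStep_iff hd O hβ, T.values_piecewiseConst]
  constructor
  · obtain ⟨c', hc'⟩ := UpwindDG.exists_isUpwindSolution O.ne hP hN hm hflux c
    refine ⟨T.piecewiseConst c', ⟨c', rfl, hc'⟩, ?_⟩
    rintro _ ⟨c₂, rfl, hc₂⟩
    rw [hc₂.unique O.ne hP hN hm hflux hc']
  · rintro _ ⟨c', rfl, hc'⟩
    -- Needed for the extrema to be attained.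
    have := T.elements_nonempty hΩ
    obtain ⟨K₁, hK₁⟩ := Finite.exists_min c
    obtain ⟨K₂, hK₂⟩ := Finite.exists_max c
    refine ⟨c K₁, c K₂, ⟨⟨K₁, rfl⟩, ?_⟩, ⟨⟨K₂, rfl⟩, ?_⟩, fun K x _ => ⟨?_, ?_⟩⟩
    · rintro _ ⟨K, rfl⟩
      exact hK₁ K
    · rintro _ ⟨K, rfl⟩
      exact hK₂ K
    · exact hc'.ge O.ne hP hN hm hflux hK₁ K
    · exact hc'.le O.ne hP hN hm hflux hK₂ K
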